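/- \textbf{Definitions.} An \emph{oriented link diagram} $D$ is a finite collection of oriented, piecewise smooth closed curves in the plane whose only singularities are finitely many transverse double points. Each double point is either virtual or a classical crossing; at a classical crossing it is specified which strand passes over, so classical crossings are positive or negative. The \emph{universe graph} $U$ of $D$ is the 4-regular multigraph whose vertices are the classical crossings and whose edges are the arcs of the link components between consecutive passages through classical crossings, together with one free loop for each link component that has no classical crossing; $c(U)$ is the number of connected components of $U$, each free loop counting as one. An \emph{Euler system} $C$ of $U$ consists of one (undirected) Euler circuit for each connected component of $U$ that contains vertices. A \emph{marked graph} is a graph without multiple edges, some of whose vertices may be looped, with a number of free loops, in which each vertex carries one of six marks: unmarked, $r$, $c$, $cr$, $u$, $ur$. The \emph{marked interlacement graph} $\mathcal L(D,C)$ has the classical crossings of $D$ as vertices; a vertex is looped if and only if the crossing is negative; two distinct vertices $v,w$ are adjacent if and only if they are interlaced with respect to $C$ (some circuit of $C$ meets them in the cyclic order $v\ldots w\ldots v\ldots w$); there are $c(U)-1$ free loops. The marks are as follows. At a crossing, the four half-edges can be paired in three ways. With respect to the link: $L$ goes straight along the components, $O$ is the smoothing that respects the orientations of the components, $N$ is the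 other smoothing. With respect to $C$ (orient its circuits arbitrarily): $\varphi$ follows $C$, $\chi$ respects the direction of $C$ without following $C$, $\psi$ does not respect the direction of $C$. The crossing is \begin{itemize} \item unmarked if $(L,O,N)=(\varphi,\chi,\psi)$, marked $r$ if $(L,O,N)=(\varphi,\psi,\chi)$, \item marked $c$ if $(L,O,N)=(\chi,\varphi,\psi)$, marked $cr$ if $(L,O,N)=(\chi,\psi,\varphi)$, \item marked $u$ if $(L,O,N)=(\psi,\chi,\varphi)$, marked $ur$ if $(L,O,N)=(\psi,\varphi,\chi)$. \end{itemize} The \emph{marked local complement} $G^v_{cru}$ of a marked graph $G$ at a vertex $v$ is obtained by (i) changing the mark of $v$ according to unmarked $\leftrightarrow u$, $r\leftrightarrow ur$, $c\leftrightarrow cr$; (ii) changing the mark of every neighbor $w\ne v$ of $v$ according to unmarked $\leftrightarrow r$, $c\leftrightarrow ur$, $u\leftrightarrow cr$; (iii) toggling the adjacency of every pair of distinct neighbors $x,y\neq v$ of $v$; loops and free loops do not change. An \emph{isomorphism} of marked graphs is a bijection of the vertices that preserves adjacency, loops and marks, the numbers of free loops being equal. \textbf{Theorem.} Let $D$ be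 an oriented link diagram, $C$ an Euler system of its universe graph, and $G=\mathcal L(D,C)$. \begin{enumerate} \item If $G'$ is any marked graph whose vertices are the classical crossings of $D$, then $G'=\mathcal L(D,C')$ for some Euler system $C'$ of $D$ if and only if $G'$ is obtained from $G$ by a finite (possibly empty) sequence of marked local complementations. \item If $G'$ is any marked graph, on any vertex set, then $G'$ is isomorphic to $\mathcal L(D,C')$ for some Euler system $C'$ of $D$ if and only if $G'$ is isomorphic to a graph obtained from $G$ by a finite (possibly empty) sequence of marked local complementations. \end{enumerate} -/

import Mathlib

/-! ## Marked graphs and marked local complementation -/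

/-- The six vertex marks; `plain` means "unmarked". -/
inductive Mark
  | plain | r | c | cr | u | ur
  deriving DecidableEq

/-- Effect of a marked local complementation at `v` on the mark of `v` itself. -/
def Mark.atCentre : Mark → Mark
  | .plain => .u
  | .u => .plain
  | .r => .ur
  | .ur => .r
  | .c => .cr
  | .cr => .c

/-- Effect of a marked local complementation at `v` on the mark of a neighbour of `v`. -/
def Mark.atNeighbour : Mark → Mark
  | .plain => .r
  | .r => .plain
  | .c => .ur
  | .ur => .c
  | .u => .cr
  | .cr => .u

/-- A (multiply) marked graph on the vertex set `V`: adjacency between distinct vertices,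
the set of looped vertices, a mark at every vertex, and a number of free loops. -/
@[ext]
structure MarkedGraph (V : Type*) where
  graph : SimpleGraph V
  looped : Set V
  mark : V → Mark
  freeLoops : ℕ

namespace MarkedGraph

open Classical in
/-- The marked local complement of `G` at `v`. Loops and free loops do not change. -/
noncomputable def localComplement {V : Type*} (G : MarkedGraph V) (v : V) : MarkedGraph V where
  graph :=
    { Adj := fun x y => x ≠ y ∧ Xor (G.graph.Adj x y) (G.graph.Adj v x ∧ G.graph.Adj v y)
      symm := ⟨by
        rintro x y ⟨hne, h⟩
        refine ⟨hne.symm, ?_⟩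
        rwa [G.graph.adj_comm y x, and_comm]⟩
      loopless := ⟨fun _ h => h.1 rfl⟩ }
  looped := G.looped
  mark := fun w =>
    if w = v then (G.mark w).atCentre
    else if G.graph.Adj v w then (G.mark w).atNeighbour
    else G.mark w
  freeLoops := G.freeLoops

/-- `G.Reaches G'`: `G'` is obtained from `G` by a finite (possibly empty) sequence of marked
local complementations. -/
def Reaches {V : Type*} (G G' : MarkedGraph V) : Prop :=
  Relation.ReflTransGen (fun A B : MarkedGraph V => ∃ v : V, B = A.localComplement v) G G'

/-- Isomorphism of marked graphs: a bijection of the vertices that preserves adjacency, loops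
and marks; the numbers of free loops agree. -/
def Isomorphic {V W : Type*} (G : MarkedGraph V) (H : MarkedGraph W) : Prop :=
  ∃ f : V ≃ W,
    (∀ x y, G.graph.Adj x y ↔ H.graph.Adj (f x) (f y)) ∧
    (∀ x, x ∈ G.looped ↔ f x ∈ H.looped) ∧
    (∀ x, G.mark x = H.mark (f x)) ∧
    G.freeLoops = H.freeLoops

end MarkedGraph

/-! ## Multigraphs with half-edges, Euler systems, interlacement -/

/-- A multigraph (multiple edges and loops allowed) together with a number of free loops.
The two ends of an edge `e` are `ends e false` and `ends e true`. -/
structure Multigraph where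
  V : Type
  E : Type
  ends : E → Bool → V
  freeLoops : ℕ

namespace Multigraph

/-- Half-edges: an edge together with one of its two ends. -/
abbrev HalfEdge (U : Multigraph) : Type := U.E × Bool

/-- The vertex at which a half-edge is attached. -/
def vert (U : Multigraph) (h : U.HalfEdge) : U.V := U.ends h.1 h.2

/-- The other half of the same edge. -/
def opp (U : Multigraph) (h : U.HalfEdge) : U.HalfEdge := (h.1, !h.2)

/-- The simple graph with an edge between any two distinct vertices joined by an edge of `U`. -/
def underlying (U : Multigraph) : SimpleGraph U.V :=
  SimpleGraph.fromRel fun v w => ∃ e : U.E, U.ends e false = v ∧ U.ends e true = w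

/-- The connected components of `U` that contain vertices. -/
abbrev Component (U : Multigraph) : Type := U.underlying.ConnectedComponent

/-- The number of connected components `c(U)`; every free loop counts as a component. -/
noncomputable def numComponents (U : Multigraph) : ℕ := Nat.card U.Component + U.freeLoops

/-- A closed walk is a cyclic list of half-edges `h₁, …, hₖ`: it leaves the vertex of `hᵢ`
through `hᵢ` and arrives through `opp hᵢ` at the vertex of `hᵢ₊₁` (indices mod `k`). It is an
Euler circuit of the component `κ` if it uses every edge of `κ` exactly once, and no other. -/
def IsEulerCircuit (U : Multigraph) (κ : U.Component) (w : Cycle U.HalfEdge) : Prop :=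
  w.Chain (fun a b => U.vert (U.opp a) = U.vert b) ∧
  (w.map Prod.fst).Nodup ∧
  ∀ e : U.E, e ∈ w.map Prod.fst ↔ U.underlying.connectedComponentMk (U.ends e false) = κ

/-- An Euler system: one Euler circuit for each connected component. A circuit is written
down in one of its two directions; the direction is not significant (the notions below do not
depend on it). -/
structure EulerSystem (U : Multigraph) where
  circuit : U.Component → Cycle U.HalfEdge
  isEulerCircuit : ∀ κ, U.IsEulerCircuit κ (circuit κ)

namespace EulerSystem

variable {U : Multigraph}

/-- `h` is a half-edge through which (the chosen direction of) `C` leaves the vertex of `h`. -/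
def Out (C : U.EulerSystem) (h : U.HalfEdge) : Prop := ∃ κ, h ∈ C.circuit κ

/-- In some circuit of `C`, the step `b` comes immediately after the step `a`. -/
def Next (C : U.EulerSystem) (a b : U.HalfEdge) : Prop :=
  ∃ (κ : U.Component) (l : List U.HalfEdge),
    ((a :: l : List U.HalfEdge) : Cycle U.HalfEdge) = C.circuit κ ∧ (l ++ [a]).head? = some b

/-- First transition determined by `C`: two half-edges at a vertex are paired if `C` passes from
one to the other. -/
def Follow (C : U.EulerSystem) (h h' : U.HalfEdge) : Prop :=
  ∃ a b, C.Next a b ∧ ((h = U.opp a ∧ h' = b) ∨ (h = b ∧ h' = U.opp a))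

/-- Second transition determined by `C`: it does not follow `C`, but pairs a half-edge through
which `C` arrives with one through which `C` leaves. -/
def Consistent (C : U.EulerSystem) (h h' : U.HalfEdge) : Prop :=
  U.vert h = U.vert h' ∧ ¬ C.Follow h h' ∧ (C.Out h ↔ ¬ C.Out h')

/-- Third transition determined by `C`: it pairs the two half-edges through which `C` arrives,
and the two through which `C` leaves. -/
def Inconsistent (C : U.EulerSystem) (h h' : U.HalfEdge) : Prop :=
  U.vert h = U.vert h' ∧ h ≠ h' ∧ (C.Out h ↔ C.Out h')

/-- Distinct vertices `v`, `w` are interlaced if some circuit of `C` meets them in the cyclic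
order `v … w … v … w`. -/
def Interlaced (C : U.EulerSystem) (v w : U.V) : Prop :=
  v ≠ w ∧ ∃ (κ : U.Component) (l : List U.HalfEdge),
    (l : Cycle U.HalfEdge) = C.circuit κ ∧
      (List.Sublist [v, w, v, w] (l.map U.vert) ∨ List.Sublist [w, v, w, v] (l.map U.vert))

end EulerSystem

end Multigraph

/-! ## Oriented link diagrams -/

/-- A finite family of curves in the plane `ℂ`, to be used on the period interval `[0, 1)`. -/
structure CurveFamily where
  ι : Type
  finite_ι : Finite ι
  curve : ι → ℝ → ℂ

namespace CurveFamily

/-- A point of the disjoint union of the parameter circles `[0, 1)`. -/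
abbrev Param (K : CurveFamily) : Type := K.ι × Set.Ico (0 : ℝ) 1

/-- The position in the plane. -/
def pos (K : CurveFamily) (p : K.Param) : ℂ := K.curve p.1 p.2

/-- The velocity vector. -/
noncomputable def tangent (K : CurveFamily) (p : K.Param) : ℂ := deriv (K.curve p.1) p.2

/-- The points of the plane through which the family passes at least twice. -/
def doublePoints (K : CurveFamily) : Set ℂ := {z | ∃ p q : K.Param, p ≠ q ∧ K.pos p = z ∧ K.pos q = z}

end CurveFamily

/-- The determinant of the pair of plane vectors `(a, b)`. -/
def planeDet (a b : ℂ) : ℝ := a.re * b.im - a.im * b.re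

/-- `γ` is piecewise smooth and regular on `[0, 1]`: the interval can be subdivided such that `γ`
is continuously differentiable with nonvanishing derivative on each closed piece. -/
def PiecewiseSmooth (γ : ℝ → ℂ) : Prop :=
  ∃ (n : ℕ) (t : Fin (n + 1) → ℝ), StrictMono t ∧ t 0 = 0 ∧ t (Fin.last n) = 1 ∧
    ∀ k : Fin n,
      ContDiffOn ℝ 1 γ (Set.Icc (t k.castSucc) (t k.succ)) ∧
      ∀ s ∈ Set.Icc (t k.castSucc) (t k.succ),
        derivWithin γ (Set.Icc (t k.castSucc) (t k.succ)) s ≠ 0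

/-- An oriented (virtual) link diagram: finitely many piecewise smooth closed curves in the
plane, oriented by their parameters, whose only singularities are finitely many transverse double
points. Some of the double points are classical crossings, and there one of the two strands is
the overcrossing one; the other double points are virtual crossings. -/
structure OrientedLinkDiagram extends CurveFamily where
  periodic : ∀ i, Function.Periodic (curve i) 1
  continuous_curve : ∀ i, Continuous (curve i)
  piecewiseSmooth : ∀ i, PiecewiseSmooth (curve i)
  finite_doublePoints : toCurveFamily.doublePoints.Finite
  no_triplePoints : ∀ p q s : toCurveFamily.Param,
    toCurveFamily.pos p = toCurveFamily.pos q → toCurveFamily.pos q = toCurveFamily.pos s →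
      p = q ∨ q = s ∨ p = s
  transverse : ∀ p q : toCurveFamily.Param, p ≠ q → toCurveFamily.pos p = toCurveFamily.pos q →
    DifferentiableAt ℝ (curve p.1) p.2 ∧ DifferentiableAt ℝ (curve q.1) q.2 ∧
      planeDet (toCurveFamily.tangent p) (toCurveFamily.tangent q) ≠ 0
  classical : Set ℂ
  classical_subset : classical ⊆ toCurveFamily.doublePoints
  overPassage : classical → toCurveFamily.Param
  pos_overPassage : ∀ z : classical, toCurveFamily.pos (overPassage z) = z

namespace OrientedLinkDiagram

/-- The classical crossings. -/
abbrev Crossing (D : OrientedLinkDiagram) : Type := D.classical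

/-- A classical crossing is negative if the directions of the overcrossing and the undercrossing
strand, in this order, form a negatively oriented basis of the plane. -/
def Negative (D : OrientedLinkDiagram) (z : D.Crossing) : Prop :=
  ∃ q : D.Param, q ≠ D.overPassage z ∧ D.pos q = z ∧
    planeDet (D.tangent (D.overPassage z)) (D.tangent q) < 0

/-- The passages of the link components through classical crossings (two for each crossing). -/
abbrev Passage (D : OrientedLinkDiagram) : Type := {p : D.Param // D.pos p ∈ D.classical}

/-- The crossing that belongs to a passage. -/
def Passage.crossing {D : OrientedLinkDiagram} (p : D.Passage) : D.Crossing := ⟨D.pos p.1, p.2⟩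

/-- `q` is the next passage after `p` along a link component: one gets from `p` to `q` in the
direction of the component without meeting a classical crossing in between. (If the component has
only one passage `p`, this is `p` itself.) -/
def IsArc (D : OrientedLinkDiagram) (p q : D.Passage) : Prop :=
  p.1.1 = q.1.1 ∧ ∃ s : ℝ, (p.1.2 : ℝ) < s ∧ Int.fract s = q.1.2 ∧
    ∀ x ∈ Set.Ioo (p.1.2 : ℝ) s, D.curve p.1.1 x ∉ D.classical

/-- The arcs of the diagram, running from a passage to the next one. -/
abbrev Arc (D : OrientedLinkDiagram) : Type := {a : D.Passage × D.Passage // D.IsArc a.1 a.2}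

/-- The passage at an end of an arc: `false` is the initial end, `true` is the terminal end. -/
def Arc.passage {D : OrientedLinkDiagram} (a : D.Arc) : Bool → D.Passage
  | false => a.1.1
  | true => a.1.2

/-- The universe graph: the vertices are the classical crossings, the edges are the arcs, and
there is a free loop for each link component without classical crossings. -/
noncomputable def universeGraph (D : OrientedLinkDiagram) : Multigraph where
  V := D.Crossing
  E := D.Arc
  ends := fun a b => (a.passage b).crossing
  freeLoops := Nat.card {i : D.ι // ∀ x : ℝ, D.curve i x ∉ D.classical}

/-- The passage to which a half-edge of the universe belongs. -/
def passageOf (D : OrientedLinkDiagram) (h : D.universeGraph.HalfEdge) : D.Passage :=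
  Arc.passage (D := D) h.1 h.2

/-- First transition of the link at a crossing: go straight ahead along the components. -/
def Straight (D : OrientedLinkDiagram) (h h' : D.universeGraph.HalfEdge) : Prop :=
  D.passageOf h = D.passageOf h' ∧ h.2 ≠ h'.2

/-- Second transition of the link at a crossing: the smoothing that respects the orientations,
pairing the incoming half-edge of each passage with the outgoing one of the other. -/
def OrientedSmoothing (D : OrientedLinkDiagram) (h h' : D.universeGraph.HalfEdge) : Prop :=
  D.universeGraph.vert h = D.universeGraph.vert h' ∧ D.passageOf h ≠ D.passageOf h' ∧ h.2 ≠ h'.2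

/-- The transitions `R` and `S` agree at the vertex `v`. -/
def AgreeAt (D : OrientedLinkDiagram) (v : D.Crossing)
    (R S : D.universeGraph.HalfEdge → D.universeGraph.HalfEdge → Prop) : Prop :=
  ∀ h h', D.universeGraph.vert h = v → D.universeGraph.vert h' = v → (R h h' ↔ S h h')

open Classical in
/-- The mark of a crossing with respect to an Euler system `C`. At each crossing the link has three
transitions (straight; orientation-respecting smoothing; the remaining smoothing), and so does `C`
(follow; consistent; inconsistent); the six marks stand for the six bijections between these
triples. The third transition of the link corresponds to the one of `C` that is left over. -/
noncomputable def markAt (D : OrientedLinkDiagram) (C : D.universeGraph.EulerSystem)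
    (v : D.Crossing) : Mark :=
  if D.AgreeAt v D.Straight C.Follow then
    if D.AgreeAt v D.OrientedSmoothing C.Consistent then .plain else .r
  else if D.AgreeAt v D.Straight C.Consistent then
    if D.AgreeAt v D.OrientedSmoothing C.Follow then .c else .cr
  else -- here the straight transition is the inconsistent one
    if D.AgreeAt v D.OrientedSmoothing C.Consistent then .u else .ur

/-- The marked interlacement graph `L(D, C)`. -/
noncomputable def interlacementGraph (D : OrientedLinkDiagram) (C : D.universeGraph.EulerSystem) :
    MarkedGraph D.Crossing where
  graph :=
    { Adj := fun v w => C.Interlaced v w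
      symm := ⟨fun _ _ ⟨hne, κ, l, hl, h⟩ => ⟨hne.symm, κ, l, hl, h.symm⟩⟩
      loopless := ⟨fun _ h => h.1 rfl⟩ }
  looped := {v | D.Negative v}
  mark := D.markAt C
  freeLoops := D.universeGraph.numComponents - 1

end OrientedLinkDiagram

/-! ## Cyclic words -/

/-! Write φ, χ, ψ for the transitions `Follow`, `Consistent`, `Inconsistent` of an Euler system C.
At a vertex v of a 4-regular graph the circuit through v falls into two closed walks from v to v,
and running through one of them backwards gives another Euler system (`IsReversal`). At v this
exchanges φ and ψ and keeps χ. A vertex interlaced with v has one passage on each walk, so exactly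
one of its passages changes direction: φ stays, χ and ψ are exchanged. At all other vertices nothing
changes. The link's own transitions L, O, N do not depend on C, so the marks change exactly as in a
marked local complementation.

Interlacement is handled as a parity: if x and y each occur twice in a circuit, they alternate iff
the number of pairs "x before y" is odd. Reversing a segment changes this number modulo 2 by (number
of x) · (number of y) in the segment, and v is interlaced with w iff the segment meets w an odd
number of times. So the interlacement of x and y is toggled iff both are interlaced with v. Hence a
reversal at v realizes the marked local complement at v (`interlacementGraph_of_isReversal`), and it
exists for every v (`exists_isReversal`); this gives the "if" direction.

For "only if", Kotzig's theorem (`exists_reversals`) joins any two Euler systems by reversals, up to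
the way the circuits are written down. The induction is on the number of vertices where C and the
target C' have different φ. If C' follows ψ of C somewhere, one reversal there repairs that vertex.
Otherwise C' follows φ or χ everywhere; if it follows χ at v, then it also does so at some w
interlaced with v (`exists_interlaced`), since otherwise its circuit could not pass from one walk at
v to the other. Reversals at w, v, w then repair both vertices. Euler systems with equal φ have
circuits that differ at most in direction, so their marked graphs are equal
(`interlacementGraph_congr`).

The diagram enters through `fourRegular` and through the fact that L and O are two different perfect
matchings of the half-edges at a crossing. -/

namespace List

/-- The number of pairs of positions `i < j` of `l` with the letter `x` at `i` and `y` at `j`. -/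
def pairCount {α : Type*} [DecidableEq α] (x y : α) : List α → ℕ
  | [] => 0
  | a :: l => (if a = x then l.count y else 0) + pairCount x y l

/-- Sublists `x … y … x … y` or `y … x … y … x`. -/
def Alternate {α : Type*} (x y : α) (l : List α) : Prop :=
  [x, y, x, y] <+ l ∨ [y, x, y, x] <+ l

/-- The letters `a`, `b` are consecutive in the cyclic word `l`. -/
def CycConsec {α : Type*} (l : List α) (a b : α) : Prop :=
  ∃ t, a :: t ~r l ∧ (t ++ [a]).head? = some b

/-! ### Alternation of two letters as a parity -/

section pairCount

variable {α : Type*} [DecidableEq α] {x y : α}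

theorem pairCount_append (A B : List α) :
    (A ++ B).pairCount x y = A.pairCount x y + B.pairCount x y + A.count x * B.count y := by
  induction A with
  | nil => simp [pairCount]
  | cons a A ih =>
    simp only [cons_append, pairCount, ih, count_append, count_cons, beq_iff_eq]
    split_ifs <;> ring

/-- Any occurrence of `x` together with any occurrence of `y` is counted once: in `l` if `x` comes
first, in the reversed word if `y` does. -/
theorem pairCount_reverse (hxy : x ≠ y) (l : List α) :
    l.reverse.pairCount x y + l.pairCount x y = l.count x * l.count y := by
  induction l with
  | nil => simp [pairCount]
  | cons a l ih =>
    simp only [reverse_cons, pairCount_append, pairCount, count_nil, count_cons, count_reverse,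
      beq_iff_eq, ite_self]
    by_cases h : a = x
    · have h' : a ≠ y := fun h' => hxy (h.symm.trans h')
      simp only [h, if_true, if_neg hxy]
      linarith
    · simp only [if_neg h]
      split_ifs <;> linarith

theorem pairCount_eq_zero_left (h : x ∉ l) : pairCount x y l = 0 := by
  induction l with
  | nil => rfl
  | cons a l ih =>
    simp only [mem_cons, not_or] at h
    simp [pairCount, ih h.2, Ne.symm h.1]

theorem pairCount_eq_zero_right (h : y ∉ l) : pairCount x y l = 0 := by
  induction l with
  | nil => rfl
  | cons a l ih =>
    simp only [mem_cons, not_or] at h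
    simp [pairCount, ih h.2, count_eq_zero.2 h.2]

/-- Passing from `A ++ B` to `B ++ A` replaces the mixed term `A.count x * B.count y` by `B.count x
* A.count y`. As both totals are even, `A` and `B` contain each letter equally often modulo 2, so
the two products have the same parity. -/
theorem odd_pairCount_rotated {l m : List α} (h : l ~r m) (hx : Even (l.count x))
    (hy : Even (l.count y)) : Odd (l.pairCount x y) ↔ Odd (m.pairCount x y) := by
  obtain ⟨n, hn, rfl⟩ := isRotated_iff_mod.1 h
  rw [rotate_eq_drop_append_take hn]
  have hl := (take_append_drop n l).symm
  generalize take n l = A at *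
  generalize drop n l = B at *
  subst hl
  simp only [pairCount_append, count_append, Nat.even_add, Nat.odd_add, Nat.even_mul] at *
  simp only [← Nat.not_even_iff_odd]
  tauto

theorem pairCount_filter (l : List α) :
    (l.filter fun a => a = x ∨ a = y).pairCount x y = l.pairCount x y := by
  induction l with
  | nil => rfl
  | cons a l ih =>
    have hc : (l.filter fun a => a = x ∨ a = y).count y = l.count y := count_filter (by simp)
    by_cases h : a = x ∨ a = y
    · rw [filter_cons_of_pos (by simpa using h), pairCount, pairCount, ih, hc]
    · rw [filter_cons_of_neg (by simpa using h), pairCount, ih, if_neg (fun e => h (Or.inl e)),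
        zero_add]

/-- After the other letters are deleted only six words remain: `xxyy`, `xyxy`, `xyyx`, `yxxy`,
`yxyx`, `yyxx`, with counts 4, 3, 2, 2, 1, 0. The odd ones are the alternating ones. -/
theorem odd_pairCount_iff (hxy : x ≠ y) {l : List α} (hx : l.count x = 2) (hy : l.count y = 2) :
    Odd (l.pairCount x y) ↔ l.Alternate x y := by
  have key : ∀ m : List α, (∀ a ∈ m, a = x ∨ a = y) → m.count x = 2 → m.count y = 2 →
      (Odd (m.pairCount x y) ↔ m.Alternate x y) := by
    intro m hm hx hy
    have hlen : m.length = m.count x + m.count y := by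
      clear hx hy
      induction m with
      | nil => rfl
      | cons a m ih =>
        have := ih fun b hb => hm b (mem_cons_of_mem _ hb)
        rcases hm a mem_cons_self with rfl | rfl <;>
          simp [hxy, hxy.symm, this] <;> omega
    rw [hx, hy] at hlen
    match m, hlen with
    | [a, b, c, d], _ =>
      rcases hm a (by simp) with h1 | h1 <;> rcases hm b (by simp) with h2 | h2 <;>
      rcases hm c (by simp) with h3 | h3 <;> rcases hm d (by simp) with h4 | h4 <;>
      subst_vars <;>
      simp_all [pairCount, Alternate, cons_sublist_cons', Ne.symm hxy] <;> decide
  have hf := key (l.filter fun a => a = x ∨ a = y) (by simp) (by rw [count_filter (by simp), hx])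
    (by rw [count_filter (by simp), hy])
  rw [pairCount_filter] at hf
  rw [hf]
  have sub : ∀ s : List α, (∀ a ∈ s, a = x ∨ a = y) →
      (s <+ (l.filter fun a => a = x ∨ a = y) ↔ s <+ l) := by
    intro s hs
    refine ⟨fun h => h.trans filter_sublist, fun h => ?_⟩
    have := h.filter fun a => decide (a = x ∨ a = y)
    rwa [filter_eq_self.2 (by simpa using hs)] at this
  rw [Alternate, Alternate, sub _ (by simp), sub _ (by simp)]

end pairCount

/-! ### Consecutive letters of linear and cyclic words -/

section consec

variable {α β : Type*} {a b : α} {l A B : List α}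

theorem pair_infix_append :
    [a, b] <:+: A ++ B ↔ [a, b] <:+: A ∨ [a, b] <:+: B ∨
      (A.getLast? = some a ∧ B.head? = some b) := by
  constructor
  · rintro ⟨s, t, h⟩
    rw [append_assoc] at h
    rcases append_eq_append_iff.1 h with ⟨u, rfl, h2⟩ | ⟨u, rfl, h2⟩
    · match u, h2 with
      | [], h2 => exact Or.inr (Or.inl ⟨[], t, by simpa using h2⟩)
      | [c], h2 =>
        simp only [cons_append, nil_append, cons.injEq] at h2
        obtain ⟨rfl, rfl⟩ := h2
        exact Or.inr (Or.inr ⟨by simp, by simp⟩)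
      | c :: d :: u, h2 =>
        simp only [cons_append, nil_append, cons.injEq] at h2
        obtain ⟨rfl, rfl, rfl⟩ := h2
        exact Or.inl ⟨s, u, by simp⟩
    · exact Or.inr (Or.inl ⟨u, t, by simp [h2]⟩)
  · rintro (⟨s, t, rfl⟩ | ⟨s, t, rfl⟩ | ⟨h1, h2⟩)
    · exact ⟨s, t ++ B, by simp⟩
    · exact ⟨A ++ s, t, by simp⟩
    · obtain ⟨s, rfl⟩ := getLast?_eq_some_iff.1 h1
      obtain ⟨t, rfl⟩ := head?_eq_some_iff.1 h2
      exact ⟨s, t, by simp⟩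

theorem pair_infix_reverse : [a, b] <:+: l.reverse ↔ [b, a] <:+: l := by
  rw [← reverse_infix]; simp

theorem pair_infix_map {f : β → α} {l : List β} :
    [a, b] <:+: l.map f ↔ ∃ x y, [x, y] <:+: l ∧ f x = a ∧ f y = b := by
  constructor
  · rintro ⟨s, t, h⟩
    obtain ⟨u, v, rfl, h1, rfl⟩ := append_eq_map_iff.1 h
    obtain ⟨s, u, rfl, rfl, h2⟩ := map_eq_append_iff.1 h1
    match u, h2 with
    | [x, y], h2 =>
      simp only [map_cons, map_nil, cons.injEq, and_true] at h2
      exact ⟨x, y, ⟨s, v, rfl⟩, h2⟩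
  · rintro ⟨x, y, ⟨s, t, rfl⟩, rfl, rfl⟩
    exact ⟨s.map f, t.map f, by simp⟩

/-- Repeating the first letter at the end unrolls the cyclic word, so that the wrap-around pair
becomes an ordinary infix. -/
theorem cycConsec_cons {c : α} {m : List α} :
    (c :: m).CycConsec a b ↔ [a, b] <:+: c :: m ++ [c] := by
  constructor
  · rintro ⟨t, hr, hh⟩
    obtain ⟨n, hn, h⟩ := isRotated_iff_mod.1 hr.symm
    rw [rotate_eq_drop_append_take hn] at h
    have hl := (take_append_drop n (c :: m)).symm
    generalize take n (c :: m) = s at *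
    generalize drop n (c :: m) = r at *
    match r, h with
    | [], h =>
      rw [nil_append] at h
      subst h
      simp only [append_nil, cons.injEq] at hl
      obtain ⟨rfl, rfl⟩ := hl
      obtain ⟨u, hu⟩ := head?_eq_some_iff.1 hh
      exact ⟨[], u, by simp [hu]⟩
    | d :: r, h =>
      simp only [cons_append, cons.injEq] at h
      obtain ⟨rfl, rfl⟩ := h
      have hh' : (r ++ [c]).head? = some b := by
        rcases s with - | ⟨e, s⟩
        · simp only [nil_append, cons.injEq] at hl
          obtain ⟨rfl, rfl⟩ := hl
          simpa using hh
        · simp only [cons_append, cons.injEq] at hl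
          obtain ⟨rfl, -⟩ := hl
          rcases r with - | ⟨f, r⟩ <;> simpa using hh
      obtain ⟨u, hu⟩ := head?_eq_some_iff.1 hh'
      refine ⟨s, u, ?_⟩
      rw [hl, append_assoc s (d :: r), cons_append, hu]; simp
  · rintro ⟨s, t, h⟩
    -- Either the pair ends in the repeated letter and is the wrap-around pair, or it already lies
    -- inside the word.
    rcases t.eq_nil_or_concat with rfl | ⟨t, d, rfl⟩
    · have h' : (s ++ [a]) ++ [b] = (c :: m) ++ [c] := by simpa using h
      obtain ⟨h1, h2⟩ := append_inj' h' rfl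
      simp only [cons.injEq, and_true] at h2
      subst h2
      refine ⟨s, ?_, ?_⟩
      · rw [← h1]; exact isRotated_append (l := [a])
      · rw [h1]; rfl
    · have h' : (s ++ a :: b :: t) ++ [d] = (c :: m) ++ [c] := by simpa using h
      obtain ⟨h1, -⟩ := append_inj' h' rfl
      refine ⟨b :: t ++ s, ?_, by simp⟩
      rw [← h1]; exact isRotated_append (l := a :: b :: t)

/-- The pairs inside each part, and those at the two seams. The form `(B ++ A).head?` covers empty
`B`, where the end of `A` is followed by its own beginning. -/
theorem cycConsec_append (hA : A ≠ []) :
    (A ++ B).CycConsec a b ↔ [a, b] <:+: A ∨ [a, b] <:+: B ∨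
      (A.getLast? = some a ∧ (B ++ A).head? = some b) ∨ (B.getLast? = some a ∧ A.head? = some b) := by
  obtain ⟨c, A, rfl⟩ := exists_cons_of_ne_nil hA
  rw [cons_append, cycConsec_cons]
  rw [← cons_append, append_assoc, pair_infix_append, pair_infix_append]
  have h1 : ¬ [a, b] <:+: [c] := fun h => by simpa using h.length_le
  have h2 : (B ++ [c]).head? = (B ++ c :: A).head? := by cases B <;> rfl
  rw [h2]
  simp only [h1, false_or, head?_cons]
  tauto

theorem CycConsec.of_rotated {m : List α} (h : l ~r m) (hl : l.CycConsec a b) :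
    m.CycConsec a b := by
  obtain ⟨t, ht, hh⟩ := hl
  exact ⟨t, ht.trans h, hh⟩

theorem exists_pair_infix_of_mem (h : a ∈ l) : l.getLast? = some a ∨ ∃ b, [a, b] <:+: l := by
  obtain ⟨s, t, rfl⟩ := append_of_mem h
  rcases t with - | ⟨b, t⟩
  · simp
  · exact Or.inr ⟨b, s, t, by simp⟩

theorem mem_tail_of_pair_infix (h : [a, b] <:+: l) : b ∈ l.tail := by
  obtain ⟨s, t, rfl⟩ := h
  cases s <;> simp

theorem mem_of_pair_infix (h : [a, b] <:+: l) : a ∈ l ∧ b ∈ l :=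
  ⟨h.subset (by simp), h.subset (by simp)⟩

/-- Two lists with the same head that follow the same deterministic relation are comparable. -/
theorem prefix_or_prefix_of_isChain {R : α → α → Prop} (hR : ∀ a b c, R a b → R a c → b = c) :
    ∀ {a : α} {l m : List α}, (a :: l).IsChain R → (a :: m).IsChain R → l <+: m ∨ m <+: l
  | _, [], _, _, _ => Or.inl nil_prefix
  | _, _, [], _, _ => Or.inr nil_prefix
  | a, b :: l, c :: m, hl, hm => by
    rw [isChain_cons_cons] at hl hm
    obtain rfl := hR a b c hl.1 hm.1
    rcases prefix_or_prefix_of_isChain hR hl.2 hm.2 with h | h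
    · exact Or.inl (cons_prefix_cons.2 ⟨rfl, h⟩)
    · exact Or.inr (cons_prefix_cons.2 ⟨rfl, h⟩)

end consec

end List

/-! ## Euler systems of 4-regular multigraphs -/

/-- For walks: the points of arrival, without the last one, are the points of departure without the
first. -/
theorem List.map_dropLast_eq_map_tail {α β : Type*} {f g : α → β} :
    ∀ {l : List α}, l.IsChain (fun a b => f a = g b) → l.dropLast.map f = l.tail.map g
  | [], _ => rfl
  | [_], _ => rfl
  | a :: b :: l, h => by
    rw [List.isChain_cons_cons] at h
    have := List.map_dropLast_eq_map_tail h.2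
    simpa [h.1] using this

/-- The relation that pairs `p` and `q`. -/
def PairRel {α : Type*} (p q h h' : α) : Prop := (h = p ∧ h' = q) ∨ (h = q ∧ h' = p)

theorem PairRel.comm {α : Type*} {p q h h' : α} : PairRel p q h h' ↔ PairRel q p h h' :=
  or_comm

theorem PairRel.symm {α : Type*} {p q h h' : α} (H : PairRel p q h h') : PairRel p q h' h := by
  unfold PairRel at *; tauto

namespace Multigraph

variable {U : Multigraph}

/-- Every vertex has four half-edges. -/
def FourRegular (U : Multigraph) : Prop := ∀ v, {h : U.HalfEdge | U.vert h = v}.ncard = 4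

/-- The component of a vertex. -/
abbrev comp (U : Multigraph) (v : U.V) : U.Component := U.underlying.connectedComponentMk v

@[simp] theorem opp_opp (h : U.HalfEdge) : U.opp (U.opp h) = h := by simp [opp]

@[simp] theorem opp_fst (h : U.HalfEdge) : (U.opp h).1 = h.1 := rfl

theorem opp_ne (h : U.HalfEdge) : U.opp h ≠ h := fun e => by
  simpa [opp] using congrArg Prod.snd e

theorem eq_or_eq_opp {h h' : U.HalfEdge} (e : h.1 = h'.1) : h = h' ∨ h = U.opp h' := by
  obtain ⟨e, b⟩ := h
  obtain ⟨_, b'⟩ := h'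
  obtain rfl := e
  cases b <;> cases b' <;> simp [opp]

theorem comp_ends (e : U.E) (b : Bool) : U.comp (U.ends e b) = U.comp (U.ends e false) := by
  cases b
  · rfl
  · by_cases h : U.ends e true = U.ends e false
    · rw [h]
    · refine SimpleGraph.ConnectedComponent.sound (SimpleGraph.Adj.reachable ?_)
      exact ⟨h, Or.inr ⟨e, rfl, rfl⟩⟩

theorem comp_opp (h : U.HalfEdge) : U.comp (U.vert (U.opp h)) = U.comp (U.vert h) :=
  (comp_ends _ _).trans (comp_ends _ _).symm

/-! ### Combinatorics of a single Euler circuit -/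

namespace IsEulerCircuit

variable {κ : U.Component} {l : List U.HalfEdge}

theorem nodup_edges (hl : U.IsEulerCircuit κ l) : (l.map Prod.fst).Nodup := by
  simpa using hl.2.1

theorem nodup (hl : U.IsEulerCircuit κ l) : l.Nodup := hl.nodup_edges.of_map

theorem edge_mem (hl : U.IsEulerCircuit κ l) {h : U.HalfEdge} :
    h.1 ∈ l.map Prod.fst ↔ U.comp (U.vert h) = κ := by
  have := hl.2.2 h.1
  rw [Cycle.map_coe, Cycle.mem_coe_iff] at this
  rw [this]
  exact ⟨fun e => (comp_ends _ _).trans e, fun e => (comp_ends _ _).symm.trans e⟩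

theorem mem_or_opp_mem (hl : U.IsEulerCircuit κ l) {h : U.HalfEdge} :
    h ∈ l ∨ U.opp h ∈ l ↔ U.comp (U.vert h) = κ := by
  rw [← hl.edge_mem, List.mem_map]
  constructor
  · rintro (h1 | h1)
    exacts [⟨_, h1, rfl⟩, ⟨_, h1, rfl⟩]
  · rintro ⟨x, hx, e⟩
    rcases eq_or_eq_opp e with rfl | rfl
    · exact Or.inl hx
    · exact Or.inr hx

theorem comp_of_mem (hl : U.IsEulerCircuit κ l) {h : U.HalfEdge} (hh : h ∈ l) :
    U.comp (U.vert h) = κ := hl.mem_or_opp_mem.1 (Or.inl hh)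

theorem eq_of_edge_eq (hl : U.IsEulerCircuit κ l) {h h' : U.HalfEdge} (hh : h ∈ l) (hh' : h' ∈ l)
    (e : h.1 = h'.1) : h = h' :=
  List.inj_on_of_nodup_map hl.nodup_edges hh hh' e

theorem opp_notMem (hl : U.IsEulerCircuit κ l) {h : U.HalfEdge} (hh : h ∈ l) : U.opp h ∉ l :=
  fun h' => opp_ne h (hl.eq_of_edge_eq h' hh rfl)

theorem opp_mem_iff (hl : U.IsEulerCircuit κ l) {h : U.HalfEdge} (hκ : U.comp (U.vert h) = κ) :
    U.opp h ∈ l ↔ h ∉ l := by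
  refine ⟨fun h1 h2 => hl.opp_notMem h2 h1, fun h1 => ?_⟩
  exact (hl.mem_or_opp_mem.2 hκ).resolve_left h1

theorem vert_of_cycConsec (hl : U.IsEulerCircuit κ l) {a b : U.HalfEdge} (h : l.CycConsec a b) :
    U.vert (U.opp a) = U.vert b := by
  obtain ⟨t, ht, hh⟩ := h
  have hc := hl.1
  rw [← Cycle.coe_eq_coe.2 ht, Cycle.chain_coe_cons] at hc
  obtain ⟨u, hu⟩ := List.head?_eq_some_iff.1 hh
  rw [hu, List.isChain_cons_cons] at hc
  exact hc.1

theorem isChain (hl : U.IsEulerCircuit κ l) :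
    l.IsChain (fun a b => U.vert (U.opp a) = U.vert b) := by
  rcases l with - | ⟨c, l⟩
  · simp
  · have hc := hl.1
    rw [Cycle.chain_coe_cons] at hc
    exact (List.isChain_append (l₁ := c :: l) (l₂ := [c])).1 hc |>.1

theorem map_vert_opp_isRotated (hl : U.IsEulerCircuit κ l) :
    (l.map fun h => U.vert (U.opp h)) ~r (l.map U.vert) := by
  rcases l with - | ⟨c, l⟩
  · exact List.IsRotated.refl _
  · have hc := hl.1
    rw [Cycle.chain_coe_cons] at hc
    have := List.map_dropLast_eq_map_tail (f := fun h => U.vert (U.opp h)) (g := U.vert) hc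
    rw [← List.cons_append, List.dropLast_concat] at this
    rw [this, List.cons_append, List.tail_cons]
    exact (List.isRotated_append (l' := [c])).map _

/-- The four half-edges at `v` are those through which the circuit leaves, listed in `l`, and those
through which it arrives, listed in `l.map U.opp`. Arrivals are the departures shifted by one step,
so there are two of each. -/
theorem count_vert [DecidableEq U.V] (hU : U.FourRegular) {v : U.V}
    (hl : U.IsEulerCircuit (U.comp v) l) : (l.map U.vert).count v = 2 := by
  classical
  have hc := hl.map_vert_opp_isRotated.perm.count_eq v
  have h4 := hU v
  have hnd : (l ++ l.map U.opp).Nodup := by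
    refine List.nodup_append.2 ⟨hl.nodup, hl.nodup.map (fun x y e => ?_), ?_⟩
    · simpa using congrArg U.opp e
    · rintro a ha b hb rfl
      obtain ⟨x, hx, rfl⟩ := List.mem_map.1 hb
      exact hl.opp_notMem hx ha
  have hset : {h : U.HalfEdge | U.vert h = v} =
      ↑((l ++ l.map U.opp).filter fun h => U.vert h = v).toFinset := by
    ext h
    simp only [Set.mem_ofPred_eq, List.coe_toFinset, List.mem_filter, List.mem_append,
      decide_eq_true_eq]
    refine ⟨fun e => ⟨?_, e⟩, fun e => e.2⟩
    rcases hl.mem_or_opp_mem.2 (show U.comp (U.vert h) = _ by rw [e]) with h1 | h1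
    · exact Or.inl h1
    · exact Or.inr (List.mem_map.2 ⟨_, h1, by simp⟩)
  rw [hset, Set.ncard_coe_finset, List.toFinset_card_of_nodup (hnd.filter _),
    ← List.countP_eq_length_filter, List.countP_append, List.countP_map] at h4
  have e1 : (l.map U.vert).count v = l.countP fun h => U.vert h = v := by
    rw [List.count, List.countP_map]; rfl
  have e2 : (l.map fun h => U.vert (U.opp h)).count v =
      l.countP ((fun h => decide (U.vert h = v)) ∘ U.opp) := by
    rw [List.count, List.countP_map]; rfl
  omega

theorem count_vert_eq_zero [DecidableEq U.V] {v : U.V} (hl : U.IsEulerCircuit κ l)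
    (hv : U.comp v ≠ κ) : (l.map U.vert).count v = 0 := by
  rw [List.count_eq_zero]
  intro h
  obtain ⟨x, hx, rfl⟩ := List.mem_map.1 h
  exact hv (hl.comp_of_mem hx)

theorem even_count_vert [DecidableEq U.V] (hU : U.FourRegular) (hl : U.IsEulerCircuit κ l)
    (v : U.V) : Even ((l.map U.vert).count v) := by
  by_cases hv : U.comp v = κ
  · subst hv; rw [hl.count_vert hU]; decide
  · rw [hl.count_vert_eq_zero hv]; decide

end IsEulerCircuit

/-! ### Reading an Euler system off lists that represent its circuits -/

namespace EulerSystem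

variable {C : U.EulerSystem} {κ : U.Component} {l : List U.HalfEdge}

theorem isEuler_of_coe (hl : (l : Cycle U.HalfEdge) = C.circuit κ) : U.IsEulerCircuit κ l :=
  hl ▸ C.isEulerCircuit κ

theorem exists_coe (C : U.EulerSystem) (κ : U.Component) :
    ∃ l : List U.HalfEdge, (l : Cycle U.HalfEdge) = C.circuit κ :=
  ⟨_, Quotient.out_eq' _⟩

theorem out_iff (hl : (l : Cycle U.HalfEdge) = C.circuit κ) {h : U.HalfEdge}
    (hκ : U.comp (U.vert h) = κ) : C.Out h ↔ h ∈ l := by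
  constructor
  · rintro ⟨κ', h'⟩
    obtain ⟨l', hl'⟩ := C.exists_coe κ'
    rw [← hl', Cycle.mem_coe_iff] at h'
    obtain rfl := hκ.symm.trans ((isEuler_of_coe hl').comp_of_mem h')
    rwa [← Cycle.mem_coe_iff, hl, ← hl', Cycle.mem_coe_iff]
  · intro h'
    exact ⟨κ, hl ▸ Cycle.mem_coe_iff.2 h'⟩

theorem next_iff {a b : U.HalfEdge} :
    C.Next a b ↔ ∃ κ, ∃ l : List U.HalfEdge, (l : Cycle U.HalfEdge) = C.circuit κ ∧
      l.CycConsec a b := by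
  constructor
  · rintro ⟨κ, l, hl, hh⟩
    exact ⟨κ, a :: l, hl, l, List.IsRotated.refl _, hh⟩
  · rintro ⟨κ, l, hl, t, ht, hh⟩
    exact ⟨κ, t, (Cycle.coe_eq_coe.2 ht).trans hl, hh⟩

theorem mem_of_cycConsec {l : List U.HalfEdge} {a b : U.HalfEdge} (h : l.CycConsec a b) :
    a ∈ l ∧ b ∈ l := by
  obtain ⟨t, ht, hh⟩ := h
  have hb : b ∈ t ++ [a] := List.mem_of_mem_head? hh
  exact ⟨ht.mem_iff.1 (by simp), ht.mem_iff.1 (by simpa [or_comm] using hb)⟩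

theorem follow_iff (hl : (l : Cycle U.HalfEdge) = C.circuit κ) {h h' : U.HalfEdge}
    (hκ : U.comp (U.vert h) = κ) :
    C.Follow h h' ↔ ∃ x y, l.CycConsec x y ∧ PairRel (U.opp x) y h h' := by
  constructor
  · rintro ⟨a, b, hab, hp⟩
    obtain ⟨κ', l', hl', hc⟩ := next_iff.1 hab
    have hE := isEuler_of_coe hl'
    have hκ' : U.comp (U.vert h) = κ' := by
      rcases hp with ⟨rfl, -⟩ | ⟨rfl, -⟩
      · rw [comp_opp]; exact hE.comp_of_mem (mem_of_cycConsec hc).1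
      · exact hE.comp_of_mem (mem_of_cycConsec hc).2
    obtain rfl := hκ.symm.trans hκ'
    exact ⟨a, b, hc.of_rotated (Cycle.coe_eq_coe.1 (hl'.trans hl.symm)), hp⟩
  · rintro ⟨x, y, hc, hp⟩
    exact ⟨x, y, next_iff.2 ⟨κ, l, hl, hc⟩, hp⟩

theorem Follow.symm {h h' : U.HalfEdge} (H : C.Follow h h') : C.Follow h' h := by
  obtain ⟨a, b, hab, hp⟩ := H
  exact ⟨a, b, hab, PairRel.symm hp⟩

theorem Follow.vert_eq {h h' : U.HalfEdge} (H : C.Follow h h') : U.vert h = U.vert h' := by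
  obtain ⟨l, hl⟩ := C.exists_coe (U.comp (U.vert h))
  obtain ⟨x, y, hc, hp⟩ := (follow_iff hl rfl).1 H
  have := (isEuler_of_coe hl).vert_of_cycConsec hc
  rcases hp with ⟨rfl, rfl⟩ | ⟨rfl, rfl⟩
  exacts [this, this.symm]

/-- Makes interlacement computable from any list for the circuit through `v`, in a form that is
additive under cutting and gluing. A vertex `w` of another component does not occur in that list, so
its count is 0. -/
theorem interlaced_iff [DecidableEq U.V] (hU : U.FourRegular) {v w : U.V}
    (hl : (l : Cycle U.HalfEdge) = C.circuit (U.comp v)) :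
    C.Interlaced v w ↔ v ≠ w ∧ Odd ((l.map U.vert).pairCount v w) := by
  refine and_congr_right fun hvw => ?_
  have hE := isEuler_of_coe hl
  constructor
  · rintro ⟨κ, m, hm, hs⟩
    have hmE := isEuler_of_coe hm
    have hmem : v ∈ m.map U.vert ∧ w ∈ m.map U.vert := by
      rcases hs with h | h <;> exact ⟨h.subset (by simp), h.subset (by simp)⟩
    obtain ⟨x, hx, hxv⟩ := List.mem_map.1 hmem.1
    obtain ⟨y, hy, hyw⟩ := List.mem_map.1 hmem.2
    have hκ := hmE.comp_of_mem hx
    rw [hxv] at hκ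
    have hκ' := hmE.comp_of_mem hy
    rw [hyw] at hκ'
    subst hκ
    have hr : m ~r l := Cycle.coe_eq_coe.1 (hm.trans hl.symm)
    have h2 := hmE.count_vert hU
    have h2' : (m.map U.vert).count w = 2 := by
      rw [← hκ'] at hmE; exact hmE.count_vert hU
    rw [← List.odd_pairCount_rotated (hr.map _) (hmE.even_count_vert hU v)
      (hmE.even_count_vert hU w)]
    exact (List.odd_pairCount_iff hvw h2 h2').2 hs
  · intro ho
    by_cases hw : U.comp w = U.comp v
    · refine ⟨_, l, hl, (List.odd_pairCount_iff hvw (hE.count_vert hU) ?_).1 ho⟩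
      rw [← hw] at hE; exact hE.count_vert hU
    · rw [List.pairCount_eq_zero_right (List.count_eq_zero.1 (hE.count_vert_eq_zero hw))] at ho
      exact absurd ho (by decide)

end EulerSystem

end Multigraph

/-! ### Splitting the circuit through a vertex into two closed walks -/

namespace Multigraph

variable {U : Multigraph}

namespace EulerSystem

/-- The circuit of `C` through `v` consists of the two closed walks `a :: A` and `b :: B`
from `v` to `v`. -/
structure IsSplit (C : U.EulerSystem) (v : U.V) (a b : U.HalfEdge) (A B : List U.HalfEdge) :
    Prop where
  circuit_eq : ((a :: A ++ b :: B : List U.HalfEdge) : Cycle U.HalfEdge) = C.circuit (U.comp v)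
  vert_left : U.vert a = v
  vert_right : U.vert b = v
  vert_ne_left : ∀ x ∈ A, U.vert x ≠ v
  vert_ne_right : ∀ x ∈ B, U.vert x ≠ v

theorem exists_isSplit (hU : U.FourRegular) (C : U.EulerSystem) (v : U.V) :
    ∃ a b A B, C.IsSplit v a b A B := by
  classical
  obtain ⟨l, hl⟩ := C.exists_coe (U.comp v)
  have hc := (isEuler_of_coe hl).count_vert hU
  have hv : v ∈ l.map U.vert := List.count_pos_iff.1 (by omega)
  obtain ⟨a, ha, hav⟩ := List.mem_map.1 hv
  obtain ⟨s, t, rfl⟩ := List.append_of_mem ha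
  have hr : s ++ a :: t ~r a :: (t ++ s) := List.isRotated_append (l' := a :: t)
  rw [Cycle.coe_eq_coe.2 hr] at hl
  have hc := (isEuler_of_coe hl).count_vert hU
  rw [List.map_cons, hav, List.count_cons_self] at hc
  have hv : v ∈ (t ++ s).map U.vert := List.count_pos_iff.1 (by omega)
  obtain ⟨b, hb, hbv⟩ := List.mem_map.1 hv
  obtain ⟨A, B, hAB⟩ := List.append_of_mem hb
  rw [hAB] at hl hc
  rw [List.map_append, List.map_cons, hbv, List.count_append, List.count_cons_self] at hc
  have h1 := List.count_eq_zero.1 (show (A.map U.vert).count v = 0 by omega)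
  have h2 := List.count_eq_zero.1 (show (B.map U.vert).count v = 0 by omega)
  exact ⟨a, b, A, B, hl, hav, hbv, fun x hx e => h1 (List.mem_map.2 ⟨x, hx, e⟩),
    fun x hx e => h2 (List.mem_map.2 ⟨x, hx, e⟩)⟩

/-- The four half-edges at `v`: `C` passes from `q` to `p` and from `s` to `r`. -/
structure IsFrame (C : U.EulerSystem) (v : U.V) (p q r s : U.HalfEdge) : Prop where
  vert_iff : ∀ h, U.vert h = v ↔ h = p ∨ h = q ∨ h = r ∨ h = s
  follow_iff : ∀ h h', U.vert h = v → (C.Follow h h' ↔ PairRel p q h h' ∨ PairRel r s h h')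
  ne : p ≠ r
  ne' : q ≠ s
  out_p : C.Out p
  out_r : C.Out r
  out_q : ¬ C.Out q
  out_s : ¬ C.Out s

/-- Half-edges paired by `C` within one of the two walks `a :: A`, `b :: B`. -/
def InnerFollow (a b : U.HalfEdge) (A B : List U.HalfEdge) (h h' : U.HalfEdge) : Prop :=
  ∃ x y, ([x, y] <:+: a :: A ∨ [x, y] <:+: b :: B) ∧ PairRel (U.opp x) y h h'

namespace IsSplit

variable {C : U.EulerSystem} {v : U.V} {a b : U.HalfEdge} {A B : List U.HalfEdge}

theorem isEuler (S : C.IsSplit v a b A B) :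
    U.IsEulerCircuit (U.comp v) (a :: A ++ b :: B : List U.HalfEdge) := isEuler_of_coe S.circuit_eq

theorem out_iff (S : C.IsSplit v a b A B) {h : U.HalfEdge} (hh : U.comp (U.vert h) = U.comp v) :
    C.Out h ↔ h ∈ a :: A ∨ h ∈ b :: B := by
  rw [EulerSystem.out_iff S.circuit_eq hh, List.mem_append]

/-- The last half-edge of the first walk. -/
abbrev lastLeft (_ : C.IsSplit v a b A B) : U.HalfEdge := (a :: A).getLast (List.cons_ne_nil _ _)

/-- The last half-edge of the second walk. -/
abbrev lastRight (_ : C.IsSplit v a b A B) : U.HalfEdge := (b :: B).getLast (List.cons_ne_nil _ _)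

theorem cycConsec_iff (S : C.IsSplit v a b A B) {x y : U.HalfEdge} :
    (a :: A ++ b :: B).CycConsec x y ↔ ([x, y] <:+: a :: A ∨ [x, y] <:+: b :: B) ∨
      (x = S.lastLeft ∧ y = b) ∨ (x = S.lastRight ∧ y = a) := by
  rw [List.cycConsec_append (List.cons_ne_nil _ _),
    List.getLast?_eq_getLast_of_ne_nil (List.cons_ne_nil _ _),
    List.getLast?_eq_getLast_of_ne_nil (List.cons_ne_nil _ _)]
  simp only [List.cons_append, List.head?_cons, Option.some.injEq, or_assoc, lastLeft, lastRight]
  rw [@eq_comm _ x, @eq_comm _ x, @eq_comm _ y, @eq_comm _ y]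

theorem follow_iff (S : C.IsSplit v a b A B) {h h' : U.HalfEdge}
    (hh : U.comp (U.vert h) = U.comp v) :
    C.Follow h h' ↔ InnerFollow a b A B h h' ∨ PairRel b (U.opp S.lastLeft) h h' ∨
      PairRel a (U.opp S.lastRight) h h' := by
  rw [EulerSystem.follow_iff S.circuit_eq hh]
  simp only [S.cycConsec_iff]
  constructor
  · rintro ⟨x, y, h1 | ⟨rfl, rfl⟩ | ⟨rfl, rfl⟩, h2⟩
    · exact Or.inl ⟨x, y, h1, h2⟩
    · exact Or.inr (Or.inl (PairRel.comm.1 h2))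
    · exact Or.inr (Or.inr (PairRel.comm.1 h2))
  · rintro (⟨x, y, h1, h2⟩ | h2 | h2)
    · exact ⟨x, y, Or.inl h1, h2⟩
    · exact ⟨_, _, Or.inr (Or.inl ⟨rfl, rfl⟩), PairRel.comm.1 h2⟩
    · exact ⟨_, _, Or.inr (Or.inr ⟨rfl, rfl⟩), PairRel.comm.1 h2⟩

theorem vert_ne_of_innerFollow (S : C.IsSplit v a b A B) {h h' : U.HalfEdge}
    (H : InnerFollow a b A B h h') : U.vert h ≠ v := by
  obtain ⟨x, y, hxy, hp⟩ := H
  have hy : U.vert y ≠ v := by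
    rcases hxy with h1 | h1
    · exact S.vert_ne_left y (List.mem_tail_of_pair_infix h1)
    · exact S.vert_ne_right y (List.mem_tail_of_pair_infix h1)
  rcases hp with ⟨rfl, rfl⟩ | ⟨rfl, rfl⟩
  · rwa [S.isEuler.vert_of_cycConsec (S.cycConsec_iff.2 (Or.inl hxy))]
  · exact hy

theorem lastLeft_mem (S : C.IsSplit v a b A B) : S.lastLeft ∈ a :: A := List.getLast_mem _

theorem lastRight_mem (S : C.IsSplit v a b A B) : S.lastRight ∈ b :: B := List.getLast_mem _

theorem vert_opp_lastLeft (S : C.IsSplit v a b A B) : U.vert (U.opp S.lastLeft) = v :=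
  (S.isEuler.vert_of_cycConsec (S.cycConsec_iff.2 (Or.inr (Or.inl ⟨rfl, rfl⟩)))).trans S.vert_right

theorem vert_opp_lastRight (S : C.IsSplit v a b A B) : U.vert (U.opp S.lastRight) = v :=
  (S.isEuler.vert_of_cycConsec (S.cycConsec_iff.2 (Or.inr (Or.inr ⟨rfl, rfl⟩)))).trans S.vert_left

theorem edges_disjoint (S : C.IsSplit v a b A B) {x y : U.HalfEdge} (hx : x ∈ a :: A)
    (hy : y ∈ b :: B) : x.1 ≠ y.1 := by
  intro e
  have hnd := S.isEuler.nodup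
  obtain rfl := S.isEuler.eq_of_edge_eq (List.mem_append_left _ hx) (List.mem_append_right _ hy) e
  exact (List.nodup_append.1 hnd).2.2 x hx x hy rfl

theorem eq_or_eq_of_mem (S : C.IsSplit v a b A B) {x : U.HalfEdge} (hx : x ∈ a :: A ++ b :: B)
    (hv : U.vert x = v) : x = a ∨ x = b := by
  rcases List.mem_append.1 hx with h | h <;> rcases List.mem_cons.1 h with h | h
  · exact Or.inl h
  · exact absurd hv (S.vert_ne_left x h)
  · exact Or.inr h
  · exact absurd hv (S.vert_ne_right x h)

/-- The circuit arrives at `v` by the last step of each walk and leaves by the first step of the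
other one. -/
theorem isFrame (S : C.IsSplit v a b A B) :
    C.IsFrame v b (U.opp S.lastLeft) a (U.opp S.lastRight) where
  vert_iff h := by
    constructor
    · intro hv
      have hκ : U.comp (U.vert h) = U.comp v := by rw [hv]
      rcases S.isEuler.mem_or_opp_mem.2 hκ with h1 | h1
      · rcases S.eq_or_eq_of_mem h1 hv with rfl | rfl <;> simp
      · have : h = U.opp S.lastLeft ∨ h = U.opp S.lastRight := by
          have key : ∀ y, (a :: A ++ b :: B).CycConsec (U.opp h) y → y = a ∨ y = b := by
            intro y hy
            refine S.eq_or_eq_of_mem (mem_of_cycConsec hy).2 ?_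
            rw [← S.isEuler.vert_of_cycConsec hy, opp_opp, hv]
          -- Inside a walk `v` is not met, so a step that arrives at `v` has no successor in its own
          -- walk and must be the last one.
          have ninf : ∀ y, ¬ ([U.opp h, y] <:+: a :: A ∨ [U.opp h, y] <:+: b :: B) := by
            intro y hy
            have := S.vert_ne_of_innerFollow ⟨_, _, hy, Or.inl ⟨rfl, rfl⟩⟩
            rw [opp_opp] at this
            exact this hv
          rcases List.mem_append.1 h1 with h2 | h2 <;>
            rcases List.exists_pair_infix_of_mem h2 with h3 | ⟨y, h3⟩
          · rw [List.getLast?_eq_getLast_of_ne_nil (List.cons_ne_nil _ _), Option.some.injEq] at h3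
            left; rw [lastLeft, h3, opp_opp]
          · exact absurd (Or.inl h3) (ninf y)
          · rw [List.getLast?_eq_getLast_of_ne_nil (List.cons_ne_nil _ _), Option.some.injEq] at h3
            right; rw [lastRight, h3, opp_opp]
          · exact absurd (Or.inr h3) (ninf y)
        tauto
    · rintro (rfl | rfl | rfl | rfl)
      exacts [S.vert_right, S.vert_opp_lastLeft, S.vert_left, S.vert_opp_lastRight]
  follow_iff h h' hv := by
    rw [S.follow_iff (by rw [hv])]
    exact or_iff_right fun hi => S.vert_ne_of_innerFollow hi hv
  ne := fun e => S.edges_disjoint (x := a) (y := b) (by simp) (by simp) (by rw [e])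
  ne' := fun e => S.edges_disjoint S.lastLeft_mem S.lastRight_mem (by simpa using congrArg Prod.fst e)
  out_p := (S.out_iff (by rw [S.vert_right])).2 (by simp)
  out_r := (S.out_iff (by rw [S.vert_left])).2 (by simp)
  out_q h := by
    rw [S.out_iff (by rw [S.vert_opp_lastLeft]), ← List.mem_append] at h
    exact S.isEuler.opp_notMem (List.mem_append_left _ S.lastLeft_mem) h
  out_s h := by
    rw [S.out_iff (by rw [S.vert_opp_lastRight]), ← List.mem_append] at h
    exact S.isEuler.opp_notMem (List.mem_append_right _ S.lastRight_mem) h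

/-- In the cyclic word `v A v B` each `w` in `A` comes after one `v` and each `w` in `B` after two,
so the parity is that of the number of `w` in `A`. This is also the parity for `B`, as `w` occurs an
even number of times in all. -/
theorem interlaced_iff [DecidableEq U.V] (hU : U.FourRegular) (S : C.IsSplit v a b A B)
    (w : U.V) : C.Interlaced v w ↔ Odd ((B.map U.vert).count w) := by
  rw [EulerSystem.interlaced_iff hU S.circuit_eq]
  have hA : (A.map U.vert).count v = 0 := List.count_eq_zero.2 fun h => by
    obtain ⟨x, hx, e⟩ := List.mem_map.1 h
    exact S.vert_ne_left x hx e
  have hB : (B.map U.vert).count v = 0 := List.count_eq_zero.2 fun h => by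
    obtain ⟨x, hx, e⟩ := List.mem_map.1 h
    exact S.vert_ne_right x hx e
  by_cases hvw : v = w
  · subst hvw; simp [hB]
  have he := S.isEuler.even_count_vert hU w
  simp only [List.map_append, List.map_cons, S.vert_left, S.vert_right, List.pairCount_append,
    List.pairCount, if_true, List.count_cons_self, hA, List.count_cons_of_ne hvw,
    List.count_append, List.pairCount_eq_zero_left (List.count_eq_zero.1 hA),
    List.pairCount_eq_zero_left (List.count_eq_zero.1 hB)] at he ⊢
  simp only [ne_eq, hvw, not_false_eq_true, true_and, Nat.even_add, Nat.even_mul,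
    ← Nat.not_even_iff_odd] at he ⊢
  simp at he ⊢
  rw [← Nat.not_even_iff_odd]
  tauto

end IsSplit

end EulerSystem

end Multigraph

/-! ### Transitions as perfect matchings of the half-edges at a vertex -/

namespace Multigraph

variable {U : Multigraph}

/-- The relations `R` and `S` agree at the vertex `v`. -/
def AgreeAt (U : Multigraph) (v : U.V) (R S : U.HalfEdge → U.HalfEdge → Prop) : Prop :=
  ∀ h h', U.vert h = v → U.vert h' = v → (R h h' ↔ S h h')

theorem AgreeAt.symm {v : U.V} {R S : U.HalfEdge → U.HalfEdge → Prop} (H : U.AgreeAt v R S) :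
    U.AgreeAt v S R := fun h h' e e' => (H h h' e e').symm

theorem AgreeAt.trans {v : U.V} {R S T : U.HalfEdge → U.HalfEdge → Prop} (H : U.AgreeAt v R S)
    (H' : U.AgreeAt v S T) : U.AgreeAt v R T :=
  fun h h' e e' => (H h h' e e').trans (H' h h' e e')

/-- `R` pairs the half-edges at `v`. -/
structure IsMatchingAt (U : Multigraph) (v : U.V) (R : U.HalfEdge → U.HalfEdge → Prop) : Prop where
  vert : ∀ h h', U.vert h = v → R h h' → U.vert h' = v
  symm : ∀ h h', U.vert h = v → R h h' → R h' h
  irrefl : ∀ h, U.vert h = v → ¬ R h h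
  total : ∀ h, U.vert h = v → ∃ h', R h h'
  unique : ∀ h h₁ h₂, U.vert h = v → R h h₁ → R h h₂ → h₁ = h₂

namespace EulerSystem

variable {C C' : U.EulerSystem} {v : U.V} {p q r s : U.HalfEdge}

theorem exists_isFrame (hU : U.FourRegular) (C : U.EulerSystem) (v : U.V) :
    ∃ p q r s, C.IsFrame v p q r s := by
  obtain ⟨a, b, A, B, S⟩ := C.exists_isSplit hU v
  exact ⟨_, _, _, _, S.isFrame⟩

namespace IsFrame

theorem ne_pq (F : C.IsFrame v p q r s) : p ≠ q := fun e => F.out_q (e ▸ F.out_p)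
theorem ne_ps (F : C.IsFrame v p q r s) : p ≠ s := fun e => F.out_s (e ▸ F.out_p)
theorem ne_rq (F : C.IsFrame v p q r s) : r ≠ q := fun e => F.out_q (e ▸ F.out_r)
theorem ne_rs (F : C.IsFrame v p q r s) : r ≠ s := fun e => F.out_s (e ▸ F.out_r)

theorem consistent_iff (F : C.IsFrame v p q r s) {h h' : U.HalfEdge} (hv : U.vert h = v) :
    C.Consistent h h' ↔ PairRel p s h h' ∨ PairRel r q h h' := by
  unfold Consistent
  rw [F.follow_iff h h' hv, hv, @eq_comm _ v, F.vert_iff h']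
  have := F.ne; have := F.ne'; have := F.out_p; have := F.out_q; have := F.out_r
  have := F.out_s
  unfold PairRel
  rcases (F.vert_iff h).1 hv with rfl | rfl | rfl | rfl <;> grind

theorem inconsistent_iff (F : C.IsFrame v p q r s) {h h' : U.HalfEdge} (hv : U.vert h = v) :
    C.Inconsistent h h' ↔ PairRel p r h h' ∨ PairRel q s h h' := by
  unfold Inconsistent
  rw [hv, @eq_comm _ v, F.vert_iff h']
  have := F.ne; have := F.ne'; have := F.out_p; have := F.out_q; have := F.out_r
  have := F.out_s
  unfold PairRel
  rcases (F.vert_iff h).1 hv with rfl | rfl | rfl | rfl <;> grind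

theorem isMatchingAt_of_iff (F : C.IsFrame v p q r s) {x₁ x₂ x₃ x₄ : U.HalfEdge}
    (hx : ∀ h, (h = x₁ ∨ h = x₂ ∨ h = x₃ ∨ h = x₄) ↔ (h = p ∨ h = q ∨ h = r ∨ h = s))
    {R : U.HalfEdge → U.HalfEdge → Prop}
    (hR : ∀ h h', U.vert h = v → (R h h' ↔ PairRel x₁ x₂ h h' ∨ PairRel x₃ x₄ h h')) :
    U.IsMatchingAt v R := by
  have hd : p ≠ q ∧ p ≠ s ∧ r ≠ q ∧ r ≠ s ∧ p ≠ r ∧ q ≠ s :=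
    ⟨F.ne_pq, F.ne_ps, F.ne_rq, F.ne_rs, F.ne, F.ne'⟩
  have hv : ∀ h, U.vert h = v ↔ (h = x₁ ∨ h = x₂ ∨ h = x₃ ∨ h = x₄) := fun h =>
    (F.vert_iff h).trans (hx h).symm
  have hne : x₁ ≠ x₂ ∧ x₁ ≠ x₃ ∧ x₁ ≠ x₄ ∧ x₂ ≠ x₃ ∧ x₂ ≠ x₄ ∧ x₃ ≠ x₄ := by
    have e1 := hx p
    have e2 := hx q
    have e3 := hx r
    have e4 := hx s
    grind
  unfold PairRel at hR
  constructor
  · intro h h' e H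
    rw [hR h h' e] at H
    rw [hv]; tauto
  · intro h h' e H
    rw [hR h h' e] at H
    rw [hR h' h (by rw [hv]; tauto)]
    tauto
  · intro h e H
    rw [hR h h e] at H
    grind
  · intro h e
    simp only [hR h _ e]
    rcases (hv h).1 e with h1 | h1 | h1 | h1
    exacts [⟨x₂, by tauto⟩, ⟨x₁, by tauto⟩, ⟨x₄, by tauto⟩, ⟨x₃, by tauto⟩]
  · intro h h₁ h₂ e H1 H2
    rw [hR h _ e] at H1 H2
    grind

end IsFrame

theorem isMatchingAt_follow (hU : U.FourRegular) (C : U.EulerSystem) (v : U.V) :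
    U.IsMatchingAt v C.Follow := by
  obtain ⟨p, q, r, s, F⟩ := C.exists_isFrame hU v
  exact F.isMatchingAt_of_iff (fun _ => Iff.rfl) F.follow_iff

theorem isMatchingAt_consistent (hU : U.FourRegular) (C : U.EulerSystem) (v : U.V) :
    U.IsMatchingAt v C.Consistent := by
  obtain ⟨p, q, r, s, F⟩ := C.exists_isFrame hU v
  exact F.isMatchingAt_of_iff (fun _ => by tauto) fun _ _ => F.consistent_iff

theorem isMatchingAt_inconsistent (hU : U.FourRegular) (C : U.EulerSystem) (v : U.V) :
    U.IsMatchingAt v C.Inconsistent := by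
  obtain ⟨p, q, r, s, F⟩ := C.exists_isFrame hU v
  exact F.isMatchingAt_of_iff (fun _ => by tauto) fun _ _ => F.inconsistent_iff

theorem Follow.eq (hU : U.FourRegular) {h h₁ h₂ : U.HalfEdge} (H₁ : C.Follow h h₁)
    (H₂ : C.Follow h h₂) : h₁ = h₂ :=
  (C.isMatchingAt_follow hU _).unique h h₁ h₂ rfl H₁ H₂

theorem Follow.out_iff (hU : U.FourRegular) {h h' : U.HalfEdge} (H : C.Follow h h') :
    C.Out h ↔ ¬ C.Out h' := by
  obtain ⟨p, q, r, s, F⟩ := C.exists_isFrame hU (U.vert h)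
  have := F.out_p; have := F.out_q; have := F.out_r; have := F.out_s
  rcases (F.follow_iff h h' rfl).1 H with (⟨e1, e2⟩ | ⟨e1, e2⟩) | (⟨e1, e2⟩ | ⟨e1, e2⟩) <;>
    rw [e1, e2] <;> tauto

/-- Two matchings that share a pair agree. -/
theorem IsFrame.agreeAt_of_pair (F : C.IsFrame v p q r s) {R S : U.HalfEdge → U.HalfEdge → Prop}
    (hR : U.IsMatchingAt v R) (hS : U.IsMatchingAt v S) {x : U.HalfEdge} (h1 : R p x)
    (h2 : S p x) : U.AgreeAt v R S := by
  have hd : p ≠ q ∧ p ≠ s ∧ r ≠ q ∧ r ≠ s ∧ p ≠ r ∧ q ≠ s :=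
    ⟨F.ne_pq, F.ne_ps, F.ne_rq, F.ne_rs, F.ne, F.ne'⟩
  have hp : U.vert p = v := (F.vert_iff p).2 (by simp)
  have hx := hR.vert _ _ hp h1
  have hxp : x ≠ p := fun e => hR.irrefl p hp (e ▸ h1)
  obtain ⟨y, z, hyz⟩ : ∃ y z, (∀ h, U.vert h = v ↔ h = p ∨ h = x ∨ h = y ∨ h = z) ∧
      y ≠ p ∧ y ≠ x ∧ z ≠ p ∧ z ≠ x ∧ y ≠ z := by
    rcases (F.vert_iff x).1 hx with e | rfl | rfl | rfl
    · exact absurd e hxp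
    · exact ⟨r, s, F.vert_iff, by tauto⟩
    · exact ⟨q, s, fun h => (F.vert_iff h).trans (by tauto), by tauto⟩
    · exact ⟨q, r, fun h => (F.vert_iff h).trans (by tauto), by tauto⟩
  obtain ⟨hv, hne⟩ := hyz
  -- When `p` and `x` are partners, only `y` and `z` are left, and they must be partners of each
  -- other.
  have key : ∀ T, U.IsMatchingAt v T → T p x → ∀ h h', U.vert h = v →
      (T h h' ↔ PairRel p x h h' ∨ PairRel y z h h') := by
    intro T hT hpx
    have hxp' := hT.symm _ _ hp hpx
    have hy : U.vert y = v := (hv y).2 (by simp)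
    have hz : U.vert z = v := (hv z).2 (by simp)
    have hyz : T y z := by
      obtain ⟨w, hw⟩ := hT.total y hy
      have hw' := hT.symm _ _ hy hw
      rcases (hv w).1 (hT.vert _ _ hy hw) with rfl | rfl | rfl | rfl
      · exact absurd (hT.unique _ _ _ hp hpx hw') hne.2.1.symm
      · exact absurd (hT.unique _ _ _ hx hxp' hw') hne.1.symm
      · exact absurd hw (hT.irrefl _ hy)
      · exact hw
    have hzy := hT.symm _ _ hy hyz
    intro h h' e
    have u := hT.unique h
    unfold PairRel
    constructor
    · intro H
      rcases (hv h).1 e with rfl | rfl | rfl | rfl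
      · have := u _ _ e H hpx; tauto
      · have := u _ _ e H hxp'; tauto
      · have := u _ _ e H hyz; tauto
      · have := u _ _ e H hzy; tauto
    · rintro ((⟨rfl, rfl⟩ | ⟨rfl, rfl⟩) | (⟨rfl, rfl⟩ | ⟨rfl, rfl⟩)) <;> assumption
  intro h h' e _
  rw [key R hR h1 h h' e, key S hS h2 h h' e]

/-- Four half-edges have only three perfect matchings, told apart by the partner of `p`: it is `q`
for φ, `s` for χ and `r` for ψ. -/
theorem agreeAt_cases (hU : U.FourRegular) (C : U.EulerSystem) {v : U.V}
    {R : U.HalfEdge → U.HalfEdge → Prop} (hR : U.IsMatchingAt v R) :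
    U.AgreeAt v R C.Follow ∨ U.AgreeAt v R C.Consistent ∨ U.AgreeAt v R C.Inconsistent := by
  obtain ⟨p, q, r, s, F⟩ := C.exists_isFrame hU v
  have hp : U.vert p = v := (F.vert_iff p).2 (by simp)
  obtain ⟨x, hx⟩ := hR.total p hp
  have h1 := F.follow_iff p x hp
  have h2 := F.consistent_iff (h' := x) hp
  have h3 := F.inconsistent_iff (h' := x) hp
  rcases (F.vert_iff x).1 (hR.vert _ _ hp hx) with rfl | rfl | rfl | rfl
  · exact absurd hx (hR.irrefl _ hp)
  · exact Or.inl (F.agreeAt_of_pair hR (C.isMatchingAt_follow hU v) hx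
      (h1.2 (by simp [PairRel])))
  · exact Or.inr (Or.inr (F.agreeAt_of_pair hR (C.isMatchingAt_inconsistent hU v) hx
      (h3.2 (by simp [PairRel]))))
  · exact Or.inr (Or.inl (F.agreeAt_of_pair hR (C.isMatchingAt_consistent hU v) hx
      (h2.2 (by simp [PairRel]))))

theorem not_agreeAt (hU : U.FourRegular) (C : U.EulerSystem) (v : U.V) :
    ¬ U.AgreeAt v C.Follow C.Consistent ∧ ¬ U.AgreeAt v C.Follow C.Inconsistent ∧
      ¬ U.AgreeAt v C.Consistent C.Inconsistent := by
  obtain ⟨p, q, r, s, F⟩ := C.exists_isFrame hU v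
  have hp : U.vert p = v := (F.vert_iff p).2 (by simp)
  have hq : U.vert q = v := (F.vert_iff q).2 (by simp)
  have hr : U.vert r = v := (F.vert_iff r).2 (by simp)
  have e1 := F.follow_iff p q hp
  have e2 := F.consistent_iff (h' := q) hp
  have e3 := F.inconsistent_iff (h' := q) hp
  have e4 := F.consistent_iff (h' := r) hp
  have e5 := F.inconsistent_iff (h' := r) hp
  have := F.ne_pq; have := F.ne_ps; have := F.ne_rq; have := F.ne_rs; have := F.ne; have := F.ne'
  unfold PairRel at *
  refine ⟨fun H => ?_, fun H => ?_, fun H => ?_⟩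
  · have := H p q hp hq; grind
  · have := H p q hp hq; grind
  · have := H p r hp hr; grind

/-! ### The two sides of a split circuit -/

namespace IsSplit

variable {a b : U.HalfEdge} {A B : List U.HalfEdge}

/-- The edge of `h` lies on the first walk. -/
def Left (_ : C.IsSplit v a b A B) (h : U.HalfEdge) : Prop := h.1 ∈ (a :: A).map Prod.fst

theorem left_of_mem (S : C.IsSplit v a b A B) {h : U.HalfEdge} (hh : h ∈ a :: A) : S.Left h :=
  List.mem_map.2 ⟨h, hh, rfl⟩

theorem not_left_of_mem (S : C.IsSplit v a b A B) {h : U.HalfEdge} (hh : h ∈ b :: B) :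
    ¬ S.Left h := fun H => by
  obtain ⟨x, hx, e⟩ := List.mem_map.1 H
  exact S.edges_disjoint hx hh e

theorem left_opp (S : C.IsSplit v a b A B) {h : U.HalfEdge} : S.Left (U.opp h) ↔ S.Left h :=
  Iff.rfl

theorem left_iff_of_innerFollow (S : C.IsSplit v a b A B) {h h' : U.HalfEdge}
    (H : InnerFollow a b A B h h') : S.Left h ↔ S.Left h' := by
  obtain ⟨x, y, hxy, hp⟩ := H
  have : S.Left x ↔ S.Left y := by
    rcases hxy with h1 | h1
    · exact iff_of_true (S.left_of_mem (List.mem_of_pair_infix h1).1)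
        (S.left_of_mem (List.mem_of_pair_infix h1).2)
    · exact iff_of_false (S.not_left_of_mem (List.mem_of_pair_infix h1).1)
        (S.not_left_of_mem (List.mem_of_pair_infix h1).2)
  rcases hp with ⟨rfl, rfl⟩ | ⟨rfl, rfl⟩
  exacts [this, this.symm]

theorem innerFollow_iff (S : C.IsSplit v a b A B) {h h' : U.HalfEdge}
    (hc : U.comp (U.vert h) = U.comp v) (hv : U.vert h ≠ v) :
    C.Follow h h' ↔ InnerFollow a b A B h h' := by
  rw [S.follow_iff hc]
  refine or_iff_left ?_
  rintro ((⟨rfl, -⟩ | ⟨rfl, -⟩) | (⟨rfl, -⟩ | ⟨rfl, -⟩))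
  exacts [hv S.vert_right, hv S.vert_opp_lastLeft, hv S.vert_left, hv S.vert_opp_lastRight]

theorem left_iff_of_follow (S : C.IsSplit v a b A B) {h h' : U.HalfEdge}
    (hc : U.comp (U.vert h) = U.comp v) (hv : U.vert h ≠ v) (H : C.Follow h h') :
    S.Left h ↔ S.Left h' :=
  S.left_iff_of_innerFollow ((S.innerFollow_iff hc hv).1 H)

/-- At `v` the transition χ joins the end of each walk to its own beginning, so it never changes
sides. -/
theorem left_iff_of_consistent (S : C.IsSplit v a b A B) {h h' : U.HalfEdge}
    (hv : U.vert h = v) (H : C.Consistent h h') : S.Left h ↔ S.Left h' := by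
  have h1 : ¬ S.Left b := S.not_left_of_mem (by simp)
  have h2 : ¬ S.Left (U.opp S.lastRight) :=
    fun H => S.not_left_of_mem S.lastRight_mem (S.left_opp.1 H)
  have h3 : S.Left a := S.left_of_mem (by simp)
  have h4 : S.Left (U.opp S.lastLeft) :=
    S.left_opp.2 (S.left_of_mem S.lastLeft_mem)
  rcases (S.isFrame.consistent_iff hv).1 H with (⟨rfl, rfl⟩ | ⟨rfl, rfl⟩) | (⟨rfl, rfl⟩ | ⟨rfl, rfl⟩) <;>
    tauto

/-- Each passage of `C` through a vertex other than `v` is represented by its outgoing half-edge,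
which occurs in `A` or in `B`. This reduces questions about sides to counting in these lists. -/
theorem exists_representative (hU : U.FourRegular) (S : C.IsSplit v a b A B) {h : U.HalfEdge}
    (hc : U.comp (U.vert h) = U.comp v) (hv : U.vert h ≠ v) :
    ∃ y, (y ∈ A ∨ y ∈ B) ∧ U.vert y = U.vert h ∧ (h = y ∨ C.Follow h y) ∧
      (S.Left h ↔ S.Left y) := by
  have mem : ∀ y, C.Out y → U.vert y = U.vert h → y ∈ A ∨ y ∈ B := by
    intro y hy e
    rw [S.out_iff (by rw [e, hc])] at hy
    have ha : y ≠ a := fun ea => hv (by rw [← e, ea, S.vert_left])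
    have hb : y ≠ b := fun eb => hv (by rw [← e, eb, S.vert_right])
    simpa [ha, hb] using hy
  by_cases ho : C.Out h
  · exact ⟨h, mem h ho rfl, rfl, Or.inl rfl, Iff.rfl⟩
  · obtain ⟨y, hy⟩ := (C.isMatchingAt_follow hU _).total h rfl
    have ho' : C.Out y := by
      have := Follow.out_iff hU hy; tauto
    exact ⟨y, mem y ho' hy.vert_eq.symm, hy.vert_eq.symm, Or.inr hy, S.left_iff_of_follow hc hv hy⟩

theorem count_add_count [DecidableEq U.V] (hU : U.FourRegular) (S : C.IsSplit v a b A B) {w : U.V}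
    (hc : U.comp w = U.comp v) (hv : w ≠ v) :
    (A.map U.vert).count w + (B.map U.vert).count w = 2 := by
  have hE := S.isEuler
  rw [← hc] at hE
  have := hE.count_vert hU
  rwa [List.map_append, List.map_cons, List.map_cons, S.vert_left, S.vert_right,
    List.count_append, List.count_cons_of_ne hv.symm, List.count_cons_of_ne hv.symm] at this

/-- The second walk meets the vertex 0 or 2 times, so both passages, and with them all its
half-edges, are on one side. -/
theorem left_iff_of_not_interlaced (hU : U.FourRegular) (S : C.IsSplit v a b A B)
    {h h' : U.HalfEdge} (hc : U.comp (U.vert h) = U.comp v) (hv : U.vert h ≠ v)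
    (hi : ¬ C.Interlaced v (U.vert h)) (e : U.vert h = U.vert h') : S.Left h ↔ S.Left h' := by
  classical
  obtain ⟨y, hy, ey, -, hL⟩ := S.exists_representative hU hc hv
  obtain ⟨y', hy', ey', -, hL'⟩ := S.exists_representative hU (h := h') (e ▸ hc) (e ▸ hv)
  rw [hL, hL']
  have h2 := S.count_add_count hU hc hv
  rw [S.interlaced_iff hU, Nat.not_odd_iff_even] at hi
  have pos : ∀ {L : List U.HalfEdge} {z}, z ∈ L → U.vert z = U.vert h →
      0 < (L.map U.vert).count (U.vert h) := fun hz ez =>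
    List.count_pos_iff.2 (List.mem_map.2 ⟨_, hz, ez⟩)
  have l1 : ∀ {z}, z ∈ A → S.Left z := fun hz => S.left_of_mem (List.mem_cons_of_mem _ hz)
  have l2 : ∀ {z}, z ∈ B → ¬ S.Left z := fun hz => S.not_left_of_mem (List.mem_cons_of_mem _ hz)
  rcases hy with hy | hy <;> rcases hy' with hy' | hy'
  · exact iff_of_true (l1 hy) (l1 hy')
  · have := pos hy ey
    have := pos hy' (ey'.trans e.symm)
    have : (B.map U.vert).count (U.vert h) = 1 := by omega
    rw [this] at hi; exact absurd hi (by decide)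
  · have := pos hy ey
    have := pos hy' (ey'.trans e.symm)
    have : (B.map U.vert).count (U.vert h) = 1 := by omega
    rw [this] at hi; exact absurd hi (by decide)
  · exact iff_of_false (l2 hy) (l2 hy')

/-- Each walk meets an interlaced vertex exactly once, so half-edges on the same side belong to the
same passage. -/
theorem eq_or_follow_of_left_iff (hU : U.FourRegular) (S : C.IsSplit v a b A B)
    {h h' : U.HalfEdge} (hc : U.comp (U.vert h) = U.comp v) (hv : U.vert h ≠ v)
    (hi : C.Interlaced v (U.vert h)) (e : U.vert h = U.vert h') (hl : S.Left h ↔ S.Left h') :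
    h = h' ∨ C.Follow h h' := by
  classical
  obtain ⟨y, hy, ey, hf, hL⟩ := S.exists_representative hU hc hv
  obtain ⟨y', hy', ey', hf', hL'⟩ := S.exists_representative hU (h := h') (e ▸ hc) (e ▸ hv)
  have h2 := S.count_add_count hU hc hv
  rw [S.interlaced_iff hU] at hi
  have hB : (B.map U.vert).count (U.vert h) = 1 := by
    have : (B.map U.vert).count (U.vert h) ≤ 2 := by omega
    interval_cases (B.map U.vert).count (U.vert h)
    · exact absurd hi (by decide)
    · rfl
    · exact absurd hi (by decide)
  have hA : (A.map U.vert).count (U.vert h) = 1 := by omega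
  have l1 : ∀ {z}, z ∈ A → S.Left z := fun hz => S.left_of_mem (List.mem_cons_of_mem _ hz)
  have l2 : ∀ {z}, z ∈ B → ¬ S.Left z := fun hz => S.not_left_of_mem (List.mem_cons_of_mem _ hz)
  have uniq : ∀ {L : List U.HalfEdge}, (L.map U.vert).count (U.vert h) = 1 → y ∈ L → y' ∈ L →
      y = y' := by
    intro L hL hy hy'
    rw [List.count, List.countP_map, List.countP_eq_length_filter, List.length_eq_one_iff] at hL
    obtain ⟨z, hz⟩ := hL
    have m1 : y ∈ L.filter ((fun x => x == U.vert h) ∘ U.vert) := by simp [hy, ey]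
    have m2 : y' ∈ L.filter ((fun x => x == U.vert h) ∘ U.vert) := by simp [hy', ey', e]
    rw [hz, List.mem_singleton] at m1 m2
    rw [m1, m2]
  have hyy : y = y' := by
    rcases hy with hy | hy <;> rcases hy' with hy' | hy'
    · exact uniq hA hy hy'
    · have := l1 hy; have := l2 hy'; tauto
    · have := l2 hy; have := l1 hy'; tauto
    · exact uniq hB hy hy'
  subst hyy
  rcases hf with rfl | hf <;> rcases hf' with rfl | hf'
  · exact Or.inl rfl
  · exact Or.inr hf'.symm
  · exact Or.inr hf
  · exact Or.inl (hf.symm.eq hU hf'.symm)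

end IsSplit

end EulerSystem

end Multigraph

/-! ### Reversals and their effect on transitions and interlacement -/

namespace Multigraph

variable {U : Multigraph}

namespace EulerSystem

variable {C C' : U.EulerSystem} {v : U.V} {a b : U.HalfEdge} {A B : List U.HalfEdge}

/-- `C'` is obtained from `C` by reversing one of the two closed walks from `v` to `v`. -/
structure IsReversal (C : U.EulerSystem) (v : U.V) (C' : U.EulerSystem) : Prop where
  follow_at : U.AgreeAt v C'.Follow C.Inconsistent
  consistent_at : U.AgreeAt v C'.Consistent C.Consistent
  follow_of_ne : ∀ w, w ≠ v → U.AgreeAt w C'.Follow C.Follow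
  consistent_of_interlaced : ∀ w, C.Interlaced v w → U.AgreeAt w C'.Consistent C.Inconsistent
  inconsistent_of_interlaced : ∀ w, C.Interlaced v w → U.AgreeAt w C'.Inconsistent C.Consistent
  consistent_of_not_interlaced : ∀ w, w ≠ v → ¬ C.Interlaced v w →
    U.AgreeAt w C'.Consistent C.Consistent
  interlaced_iff : ∀ x y, C'.Interlaced x y ↔
    x ≠ y ∧ Xor (C.Interlaced x y) (C.Interlaced v x ∧ C.Interlaced v y)

theorem follow_congr {κ : U.Component} (hκ : C'.circuit κ = C.circuit κ) {h h' : U.HalfEdge}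
    (hc : U.comp (U.vert h) = κ) : C'.Follow h h' ↔ C.Follow h h' := by
  obtain ⟨l, hl⟩ := C.exists_coe κ
  rw [follow_iff hl hc, follow_iff (hl.trans hκ.symm) hc]

theorem out_congr {κ : U.Component} (hκ : C'.circuit κ = C.circuit κ) {h : U.HalfEdge}
    (hc : U.comp (U.vert h) = κ) : C'.Out h ↔ C.Out h := by
  obtain ⟨l, hl⟩ := C.exists_coe κ
  rw [out_iff hl hc, out_iff (hl.trans hκ.symm) hc]

theorem interlaced_congr (hU : U.FourRegular) {x y : U.V}
    (hκ : C'.circuit (U.comp x) = C.circuit (U.comp x)) :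
    C'.Interlaced x y ↔ C.Interlaced x y := by
  classical
  obtain ⟨l, hl⟩ := C.exists_coe (U.comp x)
  rw [interlaced_iff hU hl, interlaced_iff hU (hl.trans hκ.symm)]

theorem Interlaced.comp_eq (hU : U.FourRegular) {x y : U.V} (H : C.Interlaced x y) :
    U.comp y = U.comp x := by
  classical
  obtain ⟨l, hl⟩ := C.exists_coe (U.comp x)
  rw [interlaced_iff hU hl] at H
  by_contra h
  rw [List.pairCount_eq_zero_right
    (List.count_eq_zero.1 ((isEuler_of_coe hl).count_vert_eq_zero h))] at H
  exact absurd H.2 (by decide)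

/-- The propositional core of the exchange of χ and ψ at an interlaced vertex. For two half-edges
there, `E` is equality, `F` is φ, `O` and `P` say "outgoing" before and after the reversal, and `L`
is the side; directions are kept on the left and flipped on the right. -/
theorem transitions_of_sides {F O₁ O₂ P₁ P₂ L₁ L₂ E : Prop} (o₁ : P₁ ↔ (O₁ ↔ L₁))
    (o₂ : P₂ ↔ (O₂ ↔ L₂)) (hs : (L₁ ↔ L₂) → E ∨ F) (hl : F → (L₁ ↔ L₂)) (ho : F → (O₁ ↔ ¬ O₂))
    (hE : E → (O₁ ↔ O₂) ∧ (L₁ ↔ L₂)) :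
    ((¬ F ∧ (P₁ ↔ ¬ P₂)) ↔ (¬ E ∧ (O₁ ↔ O₂))) ∧ ((¬ E ∧ (P₁ ↔ P₂)) ↔ (¬ F ∧ (O₁ ↔ ¬ O₂))) := by
  rw [o₁, o₂]
  clear o₁ o₂
  by_cases F <;> by_cases E <;> by_cases O₁ <;> by_cases O₂ <;> by_cases L₁ <;> by_cases L₂ <;>
    simp_all

/-- `C'` arises from `C` by replacing the circuit `a :: A ++ b :: B` through `v` by the circuit
that runs through its second half in the opposite direction. -/
structure IsSplit.Reversed (S : C.IsSplit v a b A B) (C' : U.EulerSystem)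
    (B' : List U.HalfEdge) : Prop where
  circuit_of_ne : ∀ κ, κ ≠ U.comp v → C'.circuit κ = C.circuit κ
  isSplit : C'.IsSplit v a (U.opp S.lastRight) A B'
  right_eq : U.opp S.lastRight :: B' = ((b :: B).map U.opp).reverse
  vert_right_eq : B'.map U.vert = (B.map U.vert).reverse

theorem IsSplit.exists_reversed (S : C.IsSplit v a b A B) :
    ∃ (C' : U.EulerSystem) (B' : List U.HalfEdge), S.Reversed C' B' := by
  classical
  have hE := S.isEuler
  have hBB : (b :: B).dropLast ++ [S.lastRight] = b :: B := List.dropLast_append_getLast _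
  have hch := List.isChain_append.1 hE.isChain
  have htail := List.map_dropLast_eq_map_tail (f := fun h => U.vert (U.opp h)) (g := U.vert) hch.2.1
  set B' := ((b :: B).dropLast.map U.opp).reverse with hB'
  have hcons : U.opp S.lastRight :: B' = ((b :: B).map U.opp).reverse := by
    conv_rhs => rw [← hBB]
    simp [hB']
  -- A reversed step departs from where the original step arrived, which is where the next original
  -- step departed.
  have hvB : B'.map U.vert = (B.map U.vert).reverse := by
    rw [hB', List.map_reverse, List.map_map]
    exact congrArg List.reverse htail
  have hEnew : U.IsEulerCircuit (U.comp v)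
      ((a :: A ++ U.opp S.lastRight :: B' : List U.HalfEdge) : Cycle U.HalfEdge) := by
    -- The edges are the same up to order, so each edge of the component is still used exactly once;
    -- only the seams of the walk have to be checked.
    have hperm : ((a :: A ++ U.opp S.lastRight :: B').map Prod.fst).Perm
        ((a :: A ++ b :: B).map Prod.fst) := by
      rw [hcons, List.map_append, List.map_append, List.map_reverse, List.map_map]
      exact List.Perm.append_left _ (List.reverse_perm _)
    refine ⟨?_, ?_, fun e => ?_⟩
    · rw [List.cons_append, Cycle.chain_coe_cons, ← List.cons_append, ← List.cons_append,
        List.isChain_append, List.isChain_append]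
      refine ⟨⟨hch.1, ?_, ?_⟩, by simp, ?_⟩
      · rw [hcons, List.isChain_reverse, List.isChain_map]
        simpa [eq_comm] using hch.2.1
      · intro x hx y hy
        rw [List.getLast?_eq_getLast_of_ne_nil (List.cons_ne_nil _ _)] at hx
        simp only [Option.mem_def, Option.some.injEq, List.head?_cons] at hx hy
        subst hx hy
        exact S.vert_opp_lastLeft.trans S.vert_opp_lastRight.symm
      · intro x hx y hy
        rw [hcons, List.getLast?_append_of_ne_nil _ (by simp), List.getLast?_reverse] at hx
        simp only [Option.mem_def, Option.some.injEq, List.head?_cons, List.map_cons] at hx hy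
        subst hx hy
        rw [opp_opp, S.vert_left, S.vert_right]
    · rw [Cycle.map_coe, Cycle.nodup_coe_iff, hperm.nodup_iff]
      exact hE.nodup_edges
    · rw [Cycle.map_coe, Cycle.mem_coe_iff, hperm.mem_iff, ← hE.2.2 e, Cycle.map_coe,
        Cycle.mem_coe_iff]
  refine ⟨⟨Function.update C.circuit (U.comp v)
    ((a :: A ++ U.opp S.lastRight :: B' : List U.HalfEdge) : Cycle U.HalfEdge), fun κ => ?_⟩, B',
    fun κ hκ => Function.update_of_ne hκ _ _, ⟨?_, S.vert_left, S.vert_opp_lastRight,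
      S.vert_ne_left, ?_⟩, hcons, hvB⟩
  · by_cases hκ : κ = U.comp v
    · subst hκ; rw [Function.update_self]; exact hEnew
    · rw [Function.update_of_ne hκ]; exact C.isEulerCircuit κ
  · exact (Function.update_self (U.comp v) _ C.circuit).symm
  · intro x hx e
    have : v ∈ B'.map U.vert := List.mem_map.2 ⟨x, hx, e⟩
    rw [hvB, List.mem_reverse] at this
    obtain ⟨y, hy, ey⟩ := List.mem_map.1 this
    exact S.vert_ne_right y hy ey

namespace IsSplit.Reversed

variable {B' : List U.HalfEdge} {S : C.IsSplit v a b A B}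

theorem lastRight_eq (R : S.Reversed C' B') : R.isSplit.lastRight = U.opp b := by
  have h1 : (U.opp S.lastRight :: B').getLast? = some R.isSplit.lastRight :=
    List.getLast?_eq_getLast_of_ne_nil (List.cons_ne_nil _ _)
  rw [R.right_eq, List.getLast?_reverse] at h1
  simpa using h1.symm

theorem isFrame (R : S.Reversed C' B') :
    C'.IsFrame v (U.opp S.lastRight) (U.opp S.lastLeft) a b := by
  have F' := R.isSplit.isFrame
  rwa [R.lastRight_eq, opp_opp] at F'

/-- A backward walk makes the same passages in the other direction, and the pairing forgets
directions. -/
theorem innerFollow_iff (R : S.Reversed C' B') (h h' : U.HalfEdge) :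
    InnerFollow a (U.opp S.lastRight) A B' h h' ↔ InnerFollow a b A B h h' := by
  unfold InnerFollow
  rw [R.right_eq]
  simp only [List.pair_infix_reverse, List.pair_infix_map]
  constructor
  · rintro ⟨x, y, h1 | ⟨y', x', h1, rfl, rfl⟩, hp⟩
    · exact ⟨x, y, Or.inl h1, hp⟩
    · rw [opp_opp] at hp
      exact ⟨y', x', Or.inr h1, PairRel.comm.1 hp⟩
  · rintro ⟨x, y, h1 | h1, hp⟩
    · exact ⟨x, y, Or.inl h1, hp⟩
    · refine ⟨U.opp y, U.opp x, Or.inr ⟨x, y, h1, rfl, rfl⟩, ?_⟩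
      rw [opp_opp]; exact PairRel.comm.1 hp

theorem follow_agreeAt (R : S.Reversed C' B') {w : U.V} (hw : w ≠ v) :
    U.AgreeAt w C'.Follow C.Follow := by
  intro h h' e _
  by_cases hc : U.comp w = U.comp v
  · subst e
    rw [S.innerFollow_iff hc hw, R.isSplit.innerFollow_iff hc hw, R.innerFollow_iff]
  · exact follow_congr (R.circuit_of_ne _ hc) (by rw [e])

theorem out_iff (R : S.Reversed C' B') {h : U.HalfEdge} (hc : U.comp (U.vert h) = U.comp v) :
    C'.Out h ↔ (C.Out h ↔ S.Left h) := by
  have hB1 : h ∈ U.opp S.lastRight :: B' ↔ U.opp h ∈ b :: B := by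
    rw [R.right_eq, List.mem_reverse, List.mem_map]
    exact ⟨fun ⟨x, hx, e⟩ => by rwa [← e, opp_opp], fun hx => ⟨_, hx, opp_opp h⟩⟩
  rw [R.isSplit.out_iff hc, S.out_iff hc, hB1]
  by_cases hL : S.Left h
  · have h1 : h ∉ b :: B := fun H => S.not_left_of_mem H hL
    have h2 : U.opp h ∉ b :: B := fun H => S.not_left_of_mem H (S.left_opp.2 hL)
    tauto
  · have h1 : h ∉ a :: A := fun H => hL (S.left_of_mem H)
    have h2 : U.opp h ∉ a :: A := fun H => hL (S.left_opp.1 (S.left_of_mem H))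
    have h3 := S.isEuler.opp_mem_iff hc
    rw [List.mem_append, List.mem_append] at h3
    tauto

theorem transitions_of_interlaced (hU : U.FourRegular) (R : S.Reversed C' B') {h h' : U.HalfEdge}
    (hi : C.Interlaced v (U.vert h)) (e : U.vert h' = U.vert h) :
    (C'.Consistent h h' ↔ C.Inconsistent h h') ∧ (C'.Inconsistent h h' ↔ C.Consistent h h') := by
  have hw : U.vert h ≠ v := hi.1.symm
  have hc := hi.comp_eq hU
  have key := transitions_of_sides (R.out_iff hc) (R.out_iff (h := h') (by rw [e, hc]))
    (S.eq_or_follow_of_left_iff hU hc hw hi e.symm) (S.left_iff_of_follow (h' := h') hc hw)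
    (fun H => H.out_iff hU) (fun H => by rw [H]; exact ⟨Iff.rfl, Iff.rfl⟩)
  unfold Consistent Inconsistent
  rw [R.follow_agreeAt hw h h' rfl e]
  exact ⟨and_congr_right fun _ => key.1, and_congr_right fun _ => key.2⟩

theorem out_iff_out_of_not_interlaced (hU : U.FourRegular) (R : S.Reversed C' B')
    {h h' : U.HalfEdge} (hw : U.vert h ≠ v) (hi : ¬ C.Interlaced v (U.vert h))
    (e : U.vert h' = U.vert h) : (C'.Out h ↔ C'.Out h') ↔ (C.Out h ↔ C.Out h') := by
  by_cases hc : U.comp (U.vert h) = U.comp v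
  · rw [R.out_iff hc, R.out_iff (h := h') (by rw [e, hc]),
      S.left_iff_of_not_interlaced hU hc hw hi e.symm]
    tauto
  · rw [out_congr (R.circuit_of_ne _ hc) rfl, out_congr (R.circuit_of_ne _ hc) (by rw [e])]

theorem interlaced_iff (hU : U.FourRegular) (R : S.Reversed C' B') (x y : U.V) :
    C'.Interlaced x y ↔ x ≠ y ∧ Xor (C.Interlaced x y) (C.Interlaced v x ∧ C.Interlaced v y) := by
  classical
  by_cases hc : U.comp x = U.comp v
  · have h1 := S.circuit_eq
    have h2 := R.isSplit.circuit_eq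
    rw [← hc] at h1 h2
    rw [EulerSystem.interlaced_iff hU h1, EulerSystem.interlaced_iff hU h2,
      S.interlaced_iff hU, S.interlaced_iff hU]
    by_cases hxy : x = y
    · simp [hxy]
    simp only [ne_eq, hxy, not_false_eq_true, true_and]
    simp only [List.map_append, List.map_cons, S.vert_right, R.isSplit.vert_right, R.vert_right_eq,
      List.pairCount_append, List.pairCount, List.count_cons, List.count_reverse]
    -- Only the pairs inside `B` are affected. Their old and new numbers add up to the product of
    -- the two counts in `B`, which is odd iff both vertices are interlaced with `v`.
    have hr := List.pairCount_reverse hxy (B.map U.vert)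
    rw [← Nat.odd_mul, ← hr, Xor]
    simp only [Nat.odd_iff]
    omega
  · rw [interlaced_congr hU (R.circuit_of_ne _ hc)]
    have : ¬ C.Interlaced v x := fun H => hc (H.comp_eq hU)
    have hne : C.Interlaced x y → x ≠ y := fun H => H.1
    unfold Xor
    tauto

theorem isReversal (hU : U.FourRegular) (R : S.Reversed C' B') : C.IsReversal v C' where
  follow_at h h' e _ := by
    rw [R.isFrame.follow_iff h h' e, S.isFrame.inconsistent_iff e, PairRel.comm (p := a) (q := b),
      PairRel.comm (p := U.opp S.lastRight)]
    exact or_comm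
  consistent_at h h' e _ := by
    rw [R.isFrame.consistent_iff e, S.isFrame.consistent_iff e,
      PairRel.comm (p := U.opp S.lastRight)]
  follow_of_ne _ := R.follow_agreeAt
  consistent_of_interlaced w hi h h' e e' := by
    subst e
    exact (R.transitions_of_interlaced hU hi e').1
  inconsistent_of_interlaced w hi h h' e e' := by
    subst e
    exact (R.transitions_of_interlaced hU hi e').2
  consistent_of_not_interlaced w hw hi h h' e e' := by
    subst e
    unfold Consistent
    have := R.out_iff_out_of_not_interlaced hU hw hi e'
    rw [R.follow_agreeAt hw h h' rfl e']
    tauto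
  interlaced_iff := R.interlaced_iff hU

end IsSplit.Reversed

theorem exists_isReversal (hU : U.FourRegular) (C : U.EulerSystem) (v : U.V) :
    ∃ C', C.IsReversal v C' := by
  obtain ⟨a, b, A, B, S⟩ := C.exists_isSplit hU v
  obtain ⟨C', B', R⟩ := S.exists_reversed
  exact ⟨C', R.isReversal hU⟩

end EulerSystem

end Multigraph

/-! ### Kotzig's theorem, and Euler systems with the same transitions -/

namespace Multigraph

variable {U : Multigraph}

theorem _root_.List.isChain_of_forall_infix {α : Type*} {R : α → α → Prop} :
    ∀ {l : List α}, (∀ x y, [x, y] <:+: l → R x y) → l.IsChain R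
  | [], _ => by simp
  | [_], _ => by simp
  | a :: b :: l, h => by
    rw [List.isChain_cons_cons]
    exact ⟨h a b ⟨[], l, rfl⟩, List.isChain_of_forall_infix fun x y hxy =>
      h x y (hxy.trans (List.suffix_cons a _).isInfix)⟩

theorem _root_.List.iff_of_forall_infix {α : Type*} {P : α → Prop} :
    ∀ {c : α} {l : List α}, (∀ x y, [x, y] <:+: c :: l → (P x ↔ P y)) → ∀ x ∈ c :: l, (P x ↔ P c)
  | c, [], _, x, hx => by rw [List.mem_singleton.1 hx]
  | c, b :: l, h, x, hx => by
    rcases List.mem_cons.1 hx with rfl | hx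
    · rfl
    · have := List.iff_of_forall_infix
        (fun x y hxy => h x y (hxy.trans (List.suffix_cons c _).isInfix)) x hx
      exact this.trans (h c b ⟨[], l, rfl⟩).symm

theorem _root_.List.CycConsec.of_infix {α : Type*} {l : List α} {x y : α} (h : [x, y] <:+: l) :
    l.CycConsec x y := by
  rcases l with - | ⟨c, l⟩
  · simp at h
  · exact List.cycConsec_cons.2 (List.pair_infix_append.2 (Or.inl h))

namespace EulerSystem

variable {C C' : U.EulerSystem} {v w : U.V}

theorem Interlaced.symm (H : C.Interlaced v w) : C.Interlaced w v := by
  obtain ⟨hne, κ, l, hl, h⟩ := H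
  exact ⟨hne.symm, κ, l, hl, h.symm⟩

/-- Suppose there is none. At `v` and at every other vertex of the component `C'` then stays on its
side of the split of `C`: χ at `v` closes up each walk, φ does not leave a walk, and χ elsewhere
occurs only at non-interlaced vertices, which lie on one side. But the circuit of `C'` has to use
edges of both sides. -/
theorem exists_interlaced (hU : U.FourRegular) (hv : U.AgreeAt v C'.Follow C.Consistent)
    (hC : ∀ w, U.AgreeAt w C'.Follow C.Follow ∨ U.AgreeAt w C'.Follow C.Consistent) :
    ∃ w, C.Interlaced v w ∧ U.AgreeAt w C'.Follow C.Consistent := by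
  by_contra! hno
  obtain ⟨a, b, A, B, S⟩ := C.exists_isSplit hU v
  obtain ⟨l, hl⟩ := C'.exists_coe (U.comp v)
  have hE := isEuler_of_coe hl
  have key : ∀ x y, [x, y] <:+: l → (S.Left x ↔ S.Left y) := by
    intro x y hxy
    have hcons := List.CycConsec.of_infix hxy
    have hvert := hE.vert_of_cycConsec hcons
    have hc : U.comp (U.vert (U.opp x)) = U.comp v := by
      rw [comp_opp]; exact hE.comp_of_mem (mem_of_cycConsec hcons).1
    have hf : C'.Follow (U.opp x) y := (follow_iff hl hc).2 ⟨x, y, hcons, Or.inl ⟨rfl, rfl⟩⟩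
    rw [← S.left_opp]
    by_cases hxv : U.vert (U.opp x) = v
    · exact S.left_iff_of_consistent hxv ((hv _ _ hxv (hvert ▸ hxv)).1 hf)
    · rcases hC (U.vert (U.opp x)) with h | h
      · exact S.left_iff_of_follow hc hxv ((h _ _ rfl hvert.symm).1 hf)
      · exact S.left_iff_of_not_interlaced hU hc hxv (fun hi => hno _ hi h) hvert
  have all : ∀ x ∈ l, ∀ y ∈ l, (S.Left x ↔ S.Left y) := by
    intro x hx y hy
    rcases l with - | ⟨c, l⟩
    · simp at hx
    · exact (List.iff_of_forall_infix key x hx).trans (List.iff_of_forall_infix key y hy).symm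
  have ha : S.Left a := S.left_of_mem (by simp)
  have hb : ¬ S.Left b := S.not_left_of_mem (by simp)
  have hla := S.left_opp (h := a)
  have hlb := S.left_opp (h := b)
  rcases hE.mem_or_opp_mem.2 (show U.comp (U.vert a) = _ by rw [S.vert_left]) with h1 | h1 <;>
    rcases hE.mem_or_opp_mem.2 (show U.comp (U.vert b) = _ by rw [S.vert_right]) with h2 | h2 <;>
    have := all _ h1 _ h2 <;> tauto

/-- **Kotzig's theorem**: any two Euler systems are connected by a sequence of reversals. -/
theorem exists_reversals [Finite U.V] (hU : U.FourRegular) (C' : U.EulerSystem) :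
    ∀ C : U.EulerSystem, ∃ C'', Relation.ReflTransGen (fun A B => ∃ v, A.IsReversal v B) C C'' ∧
      ∀ v, U.AgreeAt v C''.Follow C'.Follow := by
  -- Induction on the number of vertices at which the two systems disagree.
  suffices H : ∀ (n : ℕ) (C : U.EulerSystem), {v | ¬ U.AgreeAt v C.Follow C'.Follow}.ncard = n →
      ∃ C'', Relation.ReflTransGen (fun A B => ∃ v, A.IsReversal v B) C C'' ∧
        ∀ v, U.AgreeAt v C''.Follow C'.Follow from fun C => H _ C rfl
  intro n
  induction n using Nat.strong_induction_on with
  | _ n ih =>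
    intro C hn
    have step : ∀ C₁, Relation.ReflTransGen (fun A B => ∃ v, A.IsReversal v B) C C₁ →
        (∀ w, U.AgreeAt w C.Follow C'.Follow → U.AgreeAt w C₁.Follow C'.Follow) →
        (∃ w, ¬ U.AgreeAt w C.Follow C'.Follow ∧ U.AgreeAt w C₁.Follow C'.Follow) →
        ∃ C'', Relation.ReflTransGen (fun A B => ∃ v, A.IsReversal v B) C C'' ∧
          ∀ v, U.AgreeAt v C''.Follow C'.Follow := by
      rintro C₁ h1 h2 ⟨w, h3, h4⟩
      obtain ⟨C'', h5, h6⟩ := ih _ (hn ▸ Set.ncard_lt_ncard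
        ⟨fun u hu h => hu (h2 u h), fun h => h h3 h4⟩ (Set.toFinite _)) C₁ rfl
      exact ⟨C'', h1.trans h5, h6⟩
    by_cases hall : ∀ v, U.AgreeAt v C.Follow C'.Follow
    · exact ⟨C, .refl, hall⟩
    push Not at hall
    obtain ⟨v, hv⟩ := hall
    by_cases hinc : ∃ w, U.AgreeAt w C'.Follow C.Inconsistent
    · obtain ⟨w, hw⟩ := hinc
      obtain ⟨C₁, R⟩ := C.exists_isReversal hU w
      have hw' := R.follow_at.trans hw.symm
      refine step C₁ (.single ⟨w, R⟩) (fun u hu => ?_) ⟨w, fun h => ?_, hw'⟩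
      · by_cases huw : u = w
        · rwa [huw]
        · exact (R.follow_of_ne u huw).trans hu
      · exact (not_agreeAt hU C w).2.1 (h.trans hw)
    · push Not at hinc
      have hC : ∀ w, U.AgreeAt w C'.Follow C.Follow ∨ U.AgreeAt w C'.Follow C.Consistent := by
        intro w
        have := agreeAt_cases hU C (C'.isMatchingAt_follow hU w)
        have := hinc w
        tauto
      have hvc : U.AgreeAt v C'.Follow C.Consistent :=
        (hC v).resolve_left fun h => hv h.symm
      obtain ⟨w, hvw, hw⟩ := exists_interlaced hU hvc hC
      -- A reversal can only install ψ as the new φ, so χ has to be turned into ψ first. The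
      -- reversal at `w` does this at `v`; the one at `v` then installs it there and turns χ into ψ
      -- at `w`; the last one installs it at `w`.
      obtain ⟨C₁, R₁⟩ := C.exists_isReversal hU w
      obtain ⟨C₂, R₂⟩ := C₁.exists_isReversal hU v
      obtain ⟨C₃, R₃⟩ := C₂.exists_isReversal hU w
      have hvw' : C₁.Interlaced v w :=
        (R₁.interlaced_iff v w).2 ⟨hvw.1, Or.inl ⟨hvw, fun h => h.2.1 rfl⟩⟩
      have hcw : U.AgreeAt w C₃.Follow C'.Follow :=
        R₃.follow_at.trans ((R₂.inconsistent_of_interlaced w hvw').trans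
          (R₁.consistent_at.trans hw.symm))
      have hcv : U.AgreeAt v C₃.Follow C'.Follow :=
        (R₃.follow_of_ne v hvw.1).trans (R₂.follow_at.trans
          ((R₁.inconsistent_of_interlaced v hvw.symm).trans hvc.symm))
      refine step C₃ (.head ⟨w, R₁⟩ (.head ⟨v, R₂⟩ (.single ⟨w, R₃⟩))) (fun u hu => ?_)
        ⟨v, hv, hcv⟩
      by_cases huw : u = w
      · rwa [huw]
      by_cases huv : u = v
      · rwa [huv]
      exact (R₃.follow_of_ne u huw).trans ((R₂.follow_of_ne u huv).trans
        ((R₁.follow_of_ne u huw).trans hu))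

/-- Following `C` is deterministic, so a walk that does so is fixed by its first step and its
length; `hp` serves only to give equal lengths. -/
theorem tail_eq_of_follow (hU : U.FourRegular) (C : U.EulerSystem) {a : U.HalfEdge}
    {t t' : List U.HalfEdge}
    (h : ∀ x y, [x, y] <:+: a :: t → C.Follow (U.opp x) y)
    (h' : ∀ x y, [x, y] <:+: a :: t' → C.Follow (U.opp x) y)
    (hp : ((a :: t).map Prod.fst).Perm ((a :: t').map Prod.fst)) : t = t' := by
  have hlen : t.length = t'.length := by simpa using hp.length_eq
  rcases List.prefix_or_prefix_of_isChain (R := fun x y => C.Follow (U.opp x) y) (fun x y z h1 h2 => Follow.eq hU h1 h2)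
    (List.isChain_of_forall_infix h) (List.isChain_of_forall_infix h') with h1 | h1
  · exact h1.eq_of_length hlen
  · exact (h1.eq_of_length hlen.symm).symm

/-- Both circuits use the edge of a common half-edge `a`. Rotated, and reversed if `C'` runs through
that edge the other way, both start with `a` and follow the same transitions. -/
theorem circuit_eq_or_eq_reverse (hU : U.FourRegular)
    (hC : ∀ v, U.AgreeAt v C.Follow C'.Follow) (v : U.V) :
    ∃ l : List U.HalfEdge, (l : Cycle U.HalfEdge) = C.circuit (U.comp v) ∧
      ((l : Cycle U.HalfEdge) = C'.circuit (U.comp v) ∨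
        ((l.map U.opp).reverse : Cycle U.HalfEdge) = C'.circuit (U.comp v)) := by
  obtain ⟨a, b, A, B, S⟩ := C.exists_isSplit hU v
  have hl := S.circuit_eq
  rw [List.cons_append] at hl
  generalize A ++ b :: B = t at hl
  have hE := isEuler_of_coe hl
  refine ⟨a :: t, hl, ?_⟩
  obtain ⟨m, hm⟩ := C'.exists_coe (U.comp v)
  have hEm := isEuler_of_coe hm
  have follow_of : ∀ {D : U.EulerSystem} {k : List U.HalfEdge},
      (k : Cycle U.HalfEdge) = D.circuit (U.comp v) → ∀ x y, [x, y] <:+: k →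
      D.Follow (U.opp x) y := by
    intro D k hk x y hxy
    have hcons := List.CycConsec.of_infix hxy
    refine (follow_iff hk ?_).2 ⟨x, y, hcons, Or.inl ⟨rfl, rfl⟩⟩
    rw [comp_opp]; exact (isEuler_of_coe hk).comp_of_mem (mem_of_cycConsec hcons).1
  have hC' : ∀ {x y}, C'.Follow x y → C.Follow x y := fun H =>
    (hC _ _ _ rfl H.vert_eq.symm).2 H
  have perm_of : ∀ {k : List U.HalfEdge}, (k : Cycle U.HalfEdge) = C'.circuit (U.comp v) →
      ((a :: t).map Prod.fst).Perm (k.map Prod.fst) := by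
    intro k hk
    refine (List.perm_ext_iff_of_nodup hE.nodup_edges (isEuler_of_coe hk).nodup_edges).2 fun e => ?_
    exact (hE.edge_mem (h := (e, false))).trans ((isEuler_of_coe hk).edge_mem (h := (e, false))).symm
  rcases hEm.mem_or_opp_mem.2 (show U.comp (U.vert a) = _ by rw [S.vert_left]) with h1 | h1
  · left
    obtain ⟨s, u, rfl⟩ := List.append_of_mem h1
    rw [Cycle.coe_eq_coe.2 (List.isRotated_append (l' := a :: u))] at hm
    rw [tail_eq_of_follow hU C (follow_of hl) (fun x y hxy => hC' (follow_of hm x y hxy))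
      (perm_of hm)]
    exact hm
  · right
    obtain ⟨s, u, rfl⟩ := List.append_of_mem h1
    -- Rotate `U.opp a` to the end, so that the reversed circuit starts with `a`.
    rw [← List.singleton_append, ← List.append_assoc,
      Cycle.coe_eq_coe.2 List.isRotated_append, ← List.append_assoc] at hm
    have hrev : (((u ++ s) ++ [U.opp a]).map U.opp).reverse
        = a :: ((u ++ s).map U.opp).reverse := by simp
    have ht : t = ((u ++ s).map U.opp).reverse := by
      refine tail_eq_of_follow hU C (follow_of hl) (fun x y hxy => ?_) ((perm_of hm).trans ?_)
      · rw [← hrev, List.pair_infix_reverse, List.pair_infix_map] at hxy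
        obtain ⟨x', y', h, rfl, rfl⟩ := hxy
        rw [opp_opp]
        exact (hC' (follow_of hm _ _ h)).symm
      · rw [← hrev, List.map_reverse, List.map_map]
        exact (List.reverse_perm _).symm
    rw [ht, ← hrev, ← hm]
    simp [Function.comp_def]

theorem out_iff_out_congr (hU : U.FourRegular) (hC : ∀ v, U.AgreeAt v C.Follow C'.Follow)
    {h h' : U.HalfEdge} (e : U.vert h' = U.vert h) :
    (C.Out h ↔ C.Out h') ↔ (C'.Out h ↔ C'.Out h') := by
  obtain ⟨l, hl, hl' | hl'⟩ := circuit_eq_or_eq_reverse hU hC (U.vert h)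
  · rw [out_iff hl rfl, out_iff hl (by rw [e]), out_iff hl' rfl, out_iff hl' (by rw [e])]
  · have hE := isEuler_of_coe hl
    have hmem : ∀ x, x ∈ (l.map U.opp).reverse ↔ U.opp x ∈ l := fun x => by
      rw [List.mem_reverse, List.mem_map]
      exact ⟨fun ⟨y, hy, e⟩ => by rwa [← e, opp_opp], fun hx => ⟨_, hx, opp_opp x⟩⟩
    rw [out_iff hl rfl, out_iff hl (by rw [e]), out_iff hl' rfl, out_iff hl' (by rw [e]),
      hmem, hmem, hE.opp_mem_iff rfl, hE.opp_mem_iff (by rw [e])]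
    tauto

theorem consistent_agreeAt (hU : U.FourRegular) (hC : ∀ v, U.AgreeAt v C.Follow C'.Follow)
    (v : U.V) : U.AgreeAt v C.Consistent C'.Consistent := by
  intro h h' e e'
  have := out_iff_out_congr hU hC (h := h) (h' := h') (by rw [e, e'])
  unfold Consistent
  rw [hC v h h' e e']
  tauto

/-- For a reversed circuit, the two pair counts add up to a product of even numbers, so they have
the same parity. -/
theorem interlaced_iff_of_follow (hU : U.FourRegular)
    (hC : ∀ v, U.AgreeAt v C.Follow C'.Follow) (v w : U.V) :
    C.Interlaced v w ↔ C'.Interlaced v w := by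
  classical
  obtain ⟨l, hl, hl' | hl'⟩ := circuit_eq_or_eq_reverse hU hC v
  · rw [interlaced_iff hU hl, interlaced_iff hU hl']
  · rw [interlaced_iff hU hl, interlaced_iff hU hl']
    refine and_congr_right fun hvw => ?_
    have hE := isEuler_of_coe hl
    have hr := hE.map_vert_opp_isRotated
    have hx := hE.even_count_vert hU v
    have hy := hE.even_count_vert hU w
    rw [List.odd_pairCount_rotated hr.symm hx hy, List.map_reverse, List.map_map]
    rw [← hr.perm.count_eq] at hx hy
    have h1 := List.pairCount_reverse hvw (l.map fun h => U.vert (U.opp h))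
    have h2 : Even ((l.map fun h => U.vert (U.opp h)).count v *
      (l.map fun h => U.vert (U.opp h)).count w) := hx.mul_right _
    rw [← h1, Nat.even_add'] at h2
    exact h2.symm

end EulerSystem

end Multigraph

/-! ## The universe graph of a link diagram -/

namespace OrientedLinkDiagram

variable (D : OrientedLinkDiagram)

theorem curve_fract (i : D.ι) (t : ℝ) : D.curve i (Int.fract t) = D.curve i t := by
  have := (D.periodic i).int_mul ⌊t⌋ (Int.fract t)
  rw [mul_one, Int.fract_add_floor] at this
  exact this.symm

theorem curve_add_intCast (i : D.ι) (t : ℝ) (n : ℤ) : D.curve i (t + n) = D.curve i t := by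
  rw [← D.curve_fract i (t + n), Int.fract_add_intCast, D.curve_fract]

/-- The parameter circle point of a real parameter. -/
noncomputable def param (i : D.ι) (t : ℝ) : D.Param :=
  (i, ⟨Int.fract t, Int.fract_nonneg t, Int.fract_lt_one t⟩)

theorem pos_param (i : D.ι) (t : ℝ) : D.pos (D.param i t) = D.curve i t := D.curve_fract i t

instance : Finite D.Crossing := (D.finite_doublePoints.subset D.classical_subset).to_subtype

theorem exists_passages (v : D.Crossing) : ∃ p q : D.Passage, p ≠ q ∧
    ∀ r : D.Passage, r.crossing = v ↔ r = p ∨ r = q := by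
  obtain ⟨p, q, hpq, hp, hq⟩ := D.classical_subset v.2
  refine ⟨⟨p, hp ▸ v.2⟩, ⟨q, hq ▸ v.2⟩, fun h => hpq (congrArg Subtype.val h), fun r => ?_⟩
  constructor
  · intro h
    have hr : D.pos r.1 = v := congrArg Subtype.val h
    rcases D.no_triplePoints r.1 p q (hr.trans hp.symm) (hp.trans hq.symm) with h | h | h
    · exact Or.inl (Subtype.ext h)
    · exact absurd h hpq
    · exact Or.inr (Subtype.ext h)
  · rintro (rfl | rfl)
    exacts [Subtype.ext hp, Subtype.ext hq]

instance : Finite D.Passage := by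
  have : Finite (Set.univ : Set D.Passage) := by
    rw [Set.finite_coe_iff, ← Set.preimage_univ (f := Passage.crossing)]
    refine Set.Finite.preimage' Set.finite_univ fun v _ => ?_
    obtain ⟨p, q, -, h⟩ := D.exists_passages v
    exact (Set.toFinite {p, q}).subset fun r hr => (h r).1 hr
  exact Set.finite_univ_iff.1 this

/-- Each such parameter is that of one of the finitely many passages plus one of finitely many
integers. -/
theorem finite_parameters (i : D.ι) (a b : ℝ) :
    {t | t ∈ Set.Icc a b ∧ D.curve i t ∈ D.classical}.Finite := by
  have h1 : (Set.range fun p : D.Passage => ((p.1.2 : Set.Ico (0 : ℝ) 1) : ℝ)).Finite :=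
    Set.finite_range _
  have h2 : ((fun n : ℤ => (n : ℝ)) '' Set.Icc ⌊a⌋ ⌊b⌋).Finite := (Set.finite_Icc _ _).image _
  refine (Set.Finite.image2 (· + ·) h1 h2).subset ?_
  rintro t ⟨⟨hta, htb⟩, ht⟩
  exact ⟨Int.fract t, ⟨⟨D.param i t, by rwa [← D.pos_param] at ht⟩, rfl⟩, ⌊t⌋,
    ⟨⌊t⌋, ⟨Int.floor_le_floor hta, Int.floor_le_floor htb⟩, rfl⟩, Int.fract_add_floor t⟩

theorem curve_mem_of_fract {D : OrientedLinkDiagram} {q : D.Passage} {s : ℝ}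
    (h : Int.fract s = q.1.2) : D.curve q.1.1 s ∈ D.classical := by
  have := q.2
  rw [← D.curve_fract, h]
  exact this

theorem existsUnique_isArc_left (p : D.Passage) : ∃! q, D.IsArc p q := by
  -- The next passage is at the least element of `T`. The right end is included: there `p` itself
  -- returns after one period, so `T` is nonempty and a lone passage gets an arc to itself.
  set T := {t | t ∈ Set.Ioc (p.1.2 : ℝ) (p.1.2 + 1) ∧ D.curve p.1.1 t ∈ D.classical} with hT
  have hfin : T.Finite := (D.finite_parameters p.1.1 (p.1.2 : ℝ) (p.1.2 + 1)).subset
    fun t ht => ⟨⟨ht.1.1.le, ht.1.2⟩, ht.2⟩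
  have hne : T.Nonempty := by
    refine ⟨p.1.2 + 1, ⟨by simp, le_rfl⟩, ?_⟩
    have := D.curve_add_intCast p.1.1 p.1.2 1
    rw [Int.cast_one] at this
    rw [this]
    exact p.2
  obtain ⟨s, hs, hmin⟩ := Set.exists_min_image T id hfin hne
  refine ⟨⟨D.param p.1.1 s, by rw [D.pos_param]; exact hs.2⟩,
    ⟨rfl, s, hs.1.1, rfl, fun x hx hxc => ?_⟩, ?_⟩
  · exact absurd (hmin x ⟨⟨hx.1, hx.2.le.trans hs.1.2⟩, hxc⟩) (not_le.2 hx.2)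
  · rintro q ⟨hi, s', hs', hq, hno⟩
    have hs'c : D.curve p.1.1 s' ∈ D.classical := hi ▸ curve_mem_of_fract hq
    have : s = s' := by
      rcases lt_trichotomy s s' with h | h | h
      · exact absurd hs.2 (hno s ⟨hs.1.1, h⟩)
      · exact h
      · exact absurd (hmin s' ⟨⟨hs', h.le.trans hs.1.2⟩, hs'c⟩) (not_le.2 h)
    subst this
    exact Subtype.ext (Prod.ext hi.symm (Subtype.ext hq.symm))

theorem existsUnique_isArc_right (q : D.Passage) : ∃! p, D.IsArc p q := by
  set T := {t | t ∈ Set.Ico ((q.1.2 : ℝ) - 1) q.1.2 ∧ D.curve q.1.1 t ∈ D.classical} with hT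
  have hfin : T.Finite := (D.finite_parameters q.1.1 ((q.1.2 : ℝ) - 1) q.1.2).subset
    fun t ht => ⟨⟨ht.1.1, ht.1.2.le⟩, ht.2⟩
  have hne : T.Nonempty := by
    refine ⟨q.1.2 - 1, ⟨le_rfl, by simp⟩, ?_⟩
    have := D.curve_add_intCast q.1.1 q.1.2 (-1)
    rw [Int.cast_neg, Int.cast_one, ← sub_eq_add_neg] at this
    rw [this]
    exact q.2
  obtain ⟨s, hs, hmax⟩ := Set.exists_max_image T id hfin hne
  have hfq : Int.fract (q.1.2 : ℝ) = q.1.2 := Int.fract_eq_self.2 q.1.2.2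
  -- The arc found runs from `s` to the parameter of `q`, but `IsArc` starts at a parameter in `[0,
  -- 1)`; shifting by `⌊s⌋` brings the start to `Int.fract s`.
  refine ⟨⟨D.param q.1.1 s, by rw [D.pos_param]; exact hs.2⟩,
    ⟨rfl, q.1.2 - ⌊s⌋, ?_, ?_, fun x hx hxc => ?_⟩, ?_⟩
  · change Int.fract s < _
    rw [Int.fract]; linarith [hs.1.2]
  · rw [Int.fract_sub_intCast, hfq]
  · change D.curve q.1.1 x ∈ _ at hxc
    have hx1 : Int.fract s < x := hx.1
    rw [Int.fract] at hx1
    rw [← D.curve_add_intCast q.1.1 x ⌊s⌋] at hxc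
    have h1 := hx.2
    have h2 := hs.1.1
    refine absurd (hmax (x + ⌊s⌋) ⟨⟨by linarith, by linarith⟩, hxc⟩) (not_le.2 ?_)
    change s < x + ⌊s⌋
    linarith
  · rintro p ⟨hi, s', hs', hq, hno⟩
    have hshift : s' = q.1.2 + ⌊s'⌋ := by rw [← hq, Int.fract_add_floor]
    have hpc : D.curve q.1.1 (p.1.2 + (-⌊s'⌋ : ℤ)) ∈ D.classical := by
      rw [D.curve_add_intCast, ← hi]; exact p.2
    push_cast at hpc
    have : s = p.1.2 + -(⌊s'⌋ : ℝ) := by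
      rcases lt_trichotomy s (p.1.2 + -(⌊s'⌋ : ℝ)) with h | h | h
      · exact absurd (hmax _ ⟨⟨by linarith [hs.1.1], by linarith⟩, hpc⟩) (not_le.2 h)
      · exact h
      · refine absurd ?_ (hno (s + ⌊s'⌋) ⟨by linarith, by linarith [hs.1.2]⟩)
        rw [D.curve_add_intCast, hi]; exact hs.2
    refine Subtype.ext (Prod.ext hi (Subtype.ext ?_))
    change (p.1.2 : ℝ) = Int.fract s
    have h2 : s = p.1.2 + ((-⌊s'⌋ : ℤ) : ℝ) := by push_cast; exact this
    rw [h2, Int.fract_add_intCast, Int.fract_eq_self.2 p.1.2.2]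

theorem existsUnique_halfEdge (p : D.Passage) (b : Bool) :
    ∃! h : D.universeGraph.HalfEdge, D.passageOf h = p ∧ h.2 = b := by
  cases b
  · obtain ⟨q, hq, hu⟩ := D.existsUnique_isArc_left p
    refine ⟨((⟨(p, q), hq⟩ : D.Arc), false), ⟨rfl, rfl⟩, ?_⟩
    rintro ⟨⟨⟨p', q'⟩, ha⟩, b⟩ ⟨h1, h2⟩
    obtain rfl : b = false := h2
    obtain rfl : p' = p := h1
    obtain rfl := hu q' ha
    rfl
  · obtain ⟨q, hq, hu⟩ := D.existsUnique_isArc_right p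
    refine ⟨((⟨(q, p), hq⟩ : D.Arc), true), ⟨rfl, rfl⟩, ?_⟩
    rintro ⟨⟨⟨p', q'⟩, ha⟩, b⟩ ⟨h1, h2⟩
    obtain rfl : b = true := h2
    obtain rfl : q' = p := h1
    obtain rfl := hu p' ha
    rfl

/-- A half-edge is given by its passage and its position on the arc. -/
theorem halfEdge_ext {h h' : D.universeGraph.HalfEdge} (e : D.passageOf h = D.passageOf h')
    (e' : h.2 = h'.2) : h = h' :=
  (D.existsUnique_halfEdge _ _).unique ⟨e, e'⟩ ⟨rfl, rfl⟩

theorem vert_eq (h : D.universeGraph.HalfEdge) :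
    D.universeGraph.vert h = (D.passageOf h).crossing := rfl

/-- A half-edge is a passage together with a choice of incoming or outgoing, and each crossing has
exactly two passages. -/
theorem fourRegular : D.universeGraph.FourRegular := by
  intro v
  obtain ⟨p, q, hpq, hv⟩ := D.exists_passages v
  choose f hf _ using fun x : D.Passage × Bool => D.existsUnique_halfEdge x.1 x.2
  have hinj : f.Injective := fun x y e => by
    have h1 := hf x
    have h2 := hf y
    rw [e] at h1
    exact Prod.ext (h1.1.symm.trans h2.1) (h1.2.symm.trans h2.2)
  have hset : {h | D.universeGraph.vert h = v} = f '' (({p, q} : Set D.Passage) ×ˢ Set.univ) := by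
    ext h
    have hh : f (D.passageOf h, h.2) = h := D.halfEdge_ext (hf _).1 (hf _).2
    constructor
    · intro e
      exact ⟨(D.passageOf h, h.2), ⟨(hv _).1 e, trivial⟩, hh⟩
    · rintro ⟨x, ⟨hx, -⟩, rfl⟩
      exact (D.vert_eq _).trans ((hv _).2 (by rw [(hf x).1]; exact hx))
  rw [hset, Set.ncard_image_of_injective _ hinj, Set.ncard_prod, Set.ncard_pair hpq,
    Set.ncard_univ]
  simp

theorem isMatchingAt_straight (v : D.Crossing) :
    D.universeGraph.IsMatchingAt v D.Straight where
  vert h h' e H := by rw [← e, vert_eq, vert_eq, H.1]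
  symm h h' _ H := ⟨H.1.symm, H.2.symm⟩
  irrefl h _ H := H.2 rfl
  total h _ := by
    obtain ⟨h', ⟨h1, h2⟩, -⟩ := D.existsUnique_halfEdge (D.passageOf h) (!h.2)
    exact ⟨h', h1.symm, by rw [h2]; simp⟩
  unique h h₁ h₂ _ H₁ H₂ :=
    D.halfEdge_ext (H₁.1.symm.trans H₂.1) (by
      rw [Bool.eq_not_of_ne H₁.2.symm, Bool.eq_not_of_ne H₂.2.symm])

theorem isMatchingAt_orientedSmoothing (v : D.Crossing) :
    D.universeGraph.IsMatchingAt v D.OrientedSmoothing := by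
  obtain ⟨p, q, hpq, hv⟩ := D.exists_passages v
  refine ⟨fun h h' e H => H.1.symm.trans e, fun h h' _ H => ⟨H.1.symm, H.2.1.symm, H.2.2.symm⟩,
    fun h _ H => H.2.2 rfl, fun h e => ?_, fun h h₁ h₂ e H₁ H₂ => ?_⟩
  · have hp := (hv (D.passageOf h)).1 e
    obtain ⟨r, hr, hne⟩ : ∃ r, (r = p ∨ r = q) ∧ D.passageOf h ≠ r := by
      rcases hp with h1 | h1
      · exact ⟨q, Or.inr rfl, h1 ▸ hpq⟩
      · exact ⟨p, Or.inl rfl, h1 ▸ hpq.symm⟩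
    obtain ⟨h', ⟨h1, h2⟩, -⟩ := D.existsUnique_halfEdge r (!h.2)
    refine ⟨h', ?_, by rwa [h1], by rw [h2]; simp⟩
    rw [e, vert_eq, h1, (hv r).2 hr]
  · have hp := (hv (D.passageOf h)).1 e
    have hp₁ := (hv (D.passageOf h₁)).1 (H₁.1.symm.trans e)
    have hp₂ := (hv (D.passageOf h₂)).1 (H₂.1.symm.trans e)
    refine D.halfEdge_ext ?_ (by
      rw [Bool.eq_not_of_ne H₁.2.2.symm, Bool.eq_not_of_ne H₂.2.2.symm])
    have n₁ := H₁.2.1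
    have n₂ := H₂.2.1
    grind

theorem not_agreeAt_straight_orientedSmoothing (v : D.Crossing) :
    ¬ D.universeGraph.AgreeAt v D.Straight D.OrientedSmoothing := by
  intro H
  obtain ⟨p, q, hpq, hv⟩ := D.exists_passages v
  obtain ⟨h, ⟨h1, h2⟩, -⟩ := D.existsUnique_halfEdge p false
  obtain ⟨h', ⟨h1', h2'⟩, -⟩ := D.existsUnique_halfEdge p true
  have e : ∀ x, D.passageOf x = p → D.universeGraph.vert x = v := fun x hx => by
    rw [vert_eq, hx, (hv p).2 (Or.inl rfl)]
  exact ((H h h' (e h h1) (e h' h1')).1 ⟨h1.trans h1'.symm, by rw [h2, h2']; simp⟩).2.1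
    (h1.trans h1'.symm)

/-! ## Marks and reversals -/

variable {D} {C C' : D.universeGraph.EulerSystem} {v : D.Crossing}

/-- Ensures that each transition of the link is exactly one of φ, χ, ψ, so that the nested tests in
`markAt` do compute the bijection. -/
theorem agreeAt_follow_consistent_inconsistent (C : D.universeGraph.EulerSystem) (v : D.Crossing)
    {R : D.universeGraph.HalfEdge → D.universeGraph.HalfEdge → Prop}
    (hR : D.universeGraph.IsMatchingAt v R) :
    (D.AgreeAt v R C.Follow ∧ ¬ D.AgreeAt v R C.Consistent ∧ ¬ D.AgreeAt v R C.Inconsistent) ∨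
    (¬ D.AgreeAt v R C.Follow ∧ D.AgreeAt v R C.Consistent ∧ ¬ D.AgreeAt v R C.Inconsistent) ∨
    (¬ D.AgreeAt v R C.Follow ∧ ¬ D.AgreeAt v R C.Consistent ∧ D.AgreeAt v R C.Inconsistent) := by
  obtain ⟨n1, n2, n3⟩ := C.not_agreeAt D.fourRegular v
  have e1 : ¬ (D.AgreeAt v R C.Follow ∧ D.AgreeAt v R C.Consistent) :=
    fun h => n1 (Multigraph.AgreeAt.trans (Multigraph.AgreeAt.symm h.1) h.2)
  have e2 : ¬ (D.AgreeAt v R C.Follow ∧ D.AgreeAt v R C.Inconsistent) :=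
    fun h => n2 (Multigraph.AgreeAt.trans (Multigraph.AgreeAt.symm h.1) h.2)
  have e3 : ¬ (D.AgreeAt v R C.Consistent ∧ D.AgreeAt v R C.Inconsistent) :=
    fun h => n3 (Multigraph.AgreeAt.trans (Multigraph.AgreeAt.symm h.1) h.2)
  have e4 : D.AgreeAt v R C.Follow ∨ D.AgreeAt v R C.Consistent ∨ D.AgreeAt v R C.Inconsistent :=
    C.agreeAt_cases D.fourRegular hR
  tauto

theorem agreeAt_congr {R S T : D.universeGraph.HalfEdge → D.universeGraph.HalfEdge → Prop}
    (h : D.universeGraph.AgreeAt v S T) : D.AgreeAt v R S ↔ D.AgreeAt v R T :=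
  ⟨fun H => Multigraph.AgreeAt.trans H h, fun H => Multigraph.AgreeAt.trans H h.symm⟩

theorem markAt_congr (h1 : D.universeGraph.AgreeAt v C'.Follow C.Follow)
    (h2 : D.universeGraph.AgreeAt v C'.Consistent C.Consistent) : D.markAt C' v = D.markAt C v := by
  unfold markAt
  rw [agreeAt_congr (R := D.Straight) h1, agreeAt_congr (R := D.Straight) h2,
    agreeAt_congr (R := D.OrientedSmoothing) h1, agreeAt_congr (R := D.OrientedSmoothing) h2]

theorem not_agreeAt_both (X : D.universeGraph.HalfEdge → D.universeGraph.HalfEdge → Prop) :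
    ¬ (D.AgreeAt v D.Straight X ∧ D.AgreeAt v D.OrientedSmoothing X) := fun h =>
  D.not_agreeAt_straight_orientedSmoothing v
    (Multigraph.AgreeAt.trans h.1 (Multigraph.AgreeAt.symm h.2))

theorem markAt_centre (h1 : D.universeGraph.AgreeAt v C'.Follow C.Inconsistent)
    (h2 : D.universeGraph.AgreeAt v C'.Consistent C.Consistent) :
    D.markAt C' v = (D.markAt C v).atCentre := by
  have n1 := not_agreeAt_both (v := v) C.Follow
  have n2 := not_agreeAt_both (v := v) C.Consistent
  have n3 := not_agreeAt_both (v := v) C.Inconsistent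
  unfold markAt
  rw [agreeAt_congr (R := D.Straight) h1, agreeAt_congr (R := D.Straight) h2,
    agreeAt_congr (R := D.OrientedSmoothing) h1, agreeAt_congr (R := D.OrientedSmoothing) h2]
  have hs := agreeAt_follow_consistent_inconsistent C v (D.isMatchingAt_straight v)
  have ho := agreeAt_follow_consistent_inconsistent C v (D.isMatchingAt_orientedSmoothing v)
  -- What remains is propositional: nine combinations for L and O, of which `n1`, `n2`, `n3` exclude
  -- the three with L = O.
  generalize D.AgreeAt v D.Straight C.Follow = p₁ at *
  generalize D.AgreeAt v D.Straight C.Consistent = p₂ at *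
  generalize D.AgreeAt v D.Straight C.Inconsistent = p₃ at *
  generalize D.AgreeAt v D.OrientedSmoothing C.Follow = q₁ at *
  generalize D.AgreeAt v D.OrientedSmoothing C.Consistent = q₂ at *
  generalize D.AgreeAt v D.OrientedSmoothing C.Inconsistent = q₃ at *
  rcases hs with ⟨a₁, a₂, a₃⟩ | ⟨a₁, a₂, a₃⟩ | ⟨a₁, a₂, a₃⟩ <;>
  rcases ho with ⟨b₁, b₂, b₃⟩ | ⟨b₁, b₂, b₃⟩ | ⟨b₁, b₂, b₃⟩ <;>
  simp_all [Mark.atCentre]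

theorem markAt_neighbour (h1 : D.universeGraph.AgreeAt v C'.Follow C.Follow)
    (h2 : D.universeGraph.AgreeAt v C'.Consistent C.Inconsistent) :
    D.markAt C' v = (D.markAt C v).atNeighbour := by
  have n1 := not_agreeAt_both (v := v) C.Follow
  have n2 := not_agreeAt_both (v := v) C.Consistent
  have n3 := not_agreeAt_both (v := v) C.Inconsistent
  unfold markAt
  rw [agreeAt_congr (R := D.Straight) h1, agreeAt_congr (R := D.Straight) h2,
    agreeAt_congr (R := D.OrientedSmoothing) h1, agreeAt_congr (R := D.OrientedSmoothing) h2]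
  have hs := agreeAt_follow_consistent_inconsistent C v (D.isMatchingAt_straight v)
  have ho := agreeAt_follow_consistent_inconsistent C v (D.isMatchingAt_orientedSmoothing v)
  generalize D.AgreeAt v D.Straight C.Follow = p₁ at *
  generalize D.AgreeAt v D.Straight C.Consistent = p₂ at *
  generalize D.AgreeAt v D.Straight C.Inconsistent = p₃ at *
  generalize D.AgreeAt v D.OrientedSmoothing C.Follow = q₁ at *
  generalize D.AgreeAt v D.OrientedSmoothing C.Consistent = q₂ at *
  generalize D.AgreeAt v D.OrientedSmoothing C.Inconsistent = q₃ at *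
  rcases hs with ⟨a₁, a₂, a₃⟩ | ⟨a₁, a₂, a₃⟩ | ⟨a₁, a₂, a₃⟩ <;>
  rcases ho with ⟨b₁, b₂, b₃⟩ | ⟨b₁, b₂, b₃⟩ | ⟨b₁, b₂, b₃⟩ <;>
  simp_all [Mark.atNeighbour]

/-- The link between topology and combinatorics. Loops and free loops hold by `rfl`, since signs and
components do not involve the Euler system. -/
theorem interlacementGraph_of_isReversal (R : C.IsReversal v C') :
    D.interlacementGraph C' = (D.interlacementGraph C).localComplement v := by
  refine MarkedGraph.ext ?_ rfl ?_ rfl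
  · ext x y
    exact R.interlaced_iff x y
  · funext w
    simp only [MarkedGraph.localComplement]
    split_ifs with hw hi
    · subst hw; exact markAt_centre R.follow_at R.consistent_at
    · exact markAt_neighbour (R.follow_of_ne w hw) (R.consistent_of_interlaced w hi)
    · exact markAt_congr (R.follow_of_ne w hw) (R.consistent_of_not_interlaced w hw hi)

theorem interlacementGraph_congr (h : ∀ v, D.universeGraph.AgreeAt v C'.Follow C.Follow) :
    D.interlacementGraph C' = D.interlacementGraph C := by
  refine MarkedGraph.ext ?_ rfl ?_ rfl
  · ext x y
    exact C'.interlaced_iff_of_follow D.fourRegular h x y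
  · funext w
    exact markAt_congr (h w) (C'.consistent_agreeAt D.fourRegular h w)

theorem exists_interlacementGraph_eq_iff (C : D.universeGraph.EulerSystem)
    (G' : MarkedGraph D.Crossing) :
    (∃ C' : D.universeGraph.EulerSystem, G' = D.interlacementGraph C') ↔
      (D.interlacementGraph C).Reaches G' := by
  constructor
  · rintro ⟨C', rfl⟩
    have : Finite D.universeGraph.V := inferInstanceAs (Finite D.Crossing)
    obtain ⟨C'', h1, h2⟩ := Multigraph.EulerSystem.exists_reversals D.fourRegular C' C
    -- The reversals end in `C''`, which may differ from `C'` in the written directions of circuits;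
    -- the marked graph does not see this.
    rw [← interlacementGraph_congr h2]
    exact h1.lift D.interlacementGraph
      fun A B ⟨v, R⟩ => ⟨v, interlacementGraph_of_isReversal R⟩
  · intro h
    induction h with
    | refl => exact ⟨C, rfl⟩
    | tail _ h ih =>
      obtain ⟨C', rfl⟩ := ih
      obtain ⟨v, rfl⟩ := h
      obtain ⟨C'', R⟩ := C'.exists_isReversal D.fourRegular v
      exact ⟨C'', (interlacementGraph_of_isReversal R).symm⟩

end OrientedLinkDiagram

/-- First part: labelled graphs on the vertex set of `L(D, C)`, with equality. Second part:
arbitrary marked graphs, with equality up to isomorphism. -/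
theorem mainTheorem4 (D : OrientedLinkDiagram) (C : D.universeGraph.EulerSystem) :
    (∀ G' : MarkedGraph D.Crossing,
      (∃ C' : D.universeGraph.EulerSystem, G' = D.interlacementGraph C') ↔
        (D.interlacementGraph C).Reaches G') ∧
    (∀ (W : Type*) (G' : MarkedGraph W),
      (∃ C' : D.universeGraph.EulerSystem, G'.Isomorphic (D.interlacementGraph C')) ↔
        ∃ G'' : MarkedGraph D.Crossing,
          (D.interlacementGraph C).Reaches G'' ∧ G'.Isomorphic G'') := by
  refine ⟨OrientedLinkDiagram.exists_interlacementGraph_eq_iff C, fun W G' => ⟨?_, ?_⟩⟩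
  · rintro ⟨C', h⟩
    exact ⟨_, (OrientedLinkDiagram.exists_interlacementGraph_eq_iff C _).1 ⟨C', rfl⟩, h⟩
  · rintro ⟨G'', hG, h⟩
    obtain ⟨C', rfl⟩ := (OrientedLinkDiagram.exists_interlacementGraph_eq_iff C G'').2 hG
    exact ⟨C', h⟩
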